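/- Let $G$ be a connected (real, finite-dimensional) Lie group. Let $R$ be its radical, i.e. its unique maximal connected normal solvable subgroup, and let $N$ be its nilradical, i.e. its unique maximal connected normal nilpotent subgroup. Let $S$ be a semisimple part of $G$, i.e. $S \subseteq G$ is a connected semisimple virtual Lie subgroup (the image of a connected Lie group with trivial radical under an injective immersive homomorphism into $G$) such that $G = RS$ and the projection $G \to G/R$ restricts to a covering map $S \to G/R$. Suppose that $S$ is compact and that $S$ contains no nontrivial connected closed subgroup that is normal in $G$. Then $N$ is a maximal connected nilpotent subgroup of $G$: it is connected and nilpotent, and no connected nilpotent subgroup of $G$ properly contains it. -/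

import Mathlib

open scoped Manifold ContDiff

universe u v

namespace LieGroup

/-- The radical of a topological group `G`: the subgroup generated by all connected normal
solvable subgroups. In a Lie group it is itself connected, normal and solvable, so that it is the
unique maximal connected normal solvable subgroup. -/
def radical (G : Type u) [Group G] [TopologicalSpace G] : Subgroup G :=
  sSup {H : Subgroup G | IsConnected (H : Set G) ∧ H.Normal ∧ Group.IsSolvable H}

/-- The nilradical of a topological group `G`: the subgroup generated by all connected normal
nilpotent subgroups. In a Lie group it is itself connected, normal and nilpotent, so that it is
the unique maximal connected normal nilpotent subgroup. -/
def nilradical (G : Type u) [Group G] [TopologicalSpace G] : Subgroup G :=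
  sSup {H : Subgroup G | IsConnected (H : Set G) ∧ H.Normal ∧ Group.IsNilpotent H}

/-- A connected Lie group is semisimple if its radical is trivial. -/
structure IsConnectedSemisimple (L : Type u) [Group L] [TopologicalSpace L] : Prop where
  connected : ConnectedSpace L
  radical_eq_bot : radical L = ⊥

/-- A homomorphism of Lie groups `φ : L → G` that is an injective smooth immersion and has image
`S`; it exhibits `S` as a virtual (that is, immersed, not necessarily closed) Lie subgroup of `G`,
whose own Lie group topology is that of `L`. -/
structure IsVirtualLieSubgroup (E : Type v) [NormedAddCommGroup E] [NormedSpace ℝ E]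
    {G : Type u} [Group G] [TopologicalSpace G] [ChartedSpace E G] (n : ℕ)
    {L : Type u} [Group L] [TopologicalSpace L] [ChartedSpace (EuclideanSpace ℝ (Fin n)) L]
    (φ : L →* G) (S : Subgroup G) : Prop where
  injective : Function.Injective φ
  contMDiff : ContMDiff (𝓡 n) 𝓘(ℝ, E) ∞ φ
  immersion : ∀ x : L, Function.Injective (mfderiv (𝓡 n) 𝓘(ℝ, E) φ x)
  range_eq : φ.range = S

/-- `S` is a semisimple part of `G`: a connected semisimple virtual Lie subgroup with
`G = R S`, where `R` is the radical, such that the projection `G → G ⧸ R` restricts to a covering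
map on `S` (with the Lie group topology of `S`). -/
def IsSemisimplePart (E : Type v) [NormedAddCommGroup E] [NormedSpace ℝ E]
    {G : Type u} [Group G] [TopologicalSpace G] [ChartedSpace E G] (S : Subgroup G) : Prop :=
  ∃ (n : ℕ) (L : Type u) (_ : Group L) (_ : TopologicalSpace L)
    (_ : ChartedSpace (EuclideanSpace ℝ (Fin n)) L) (_ : LieGroup (𝓡 n) ∞ L) (φ : L →* G),
    IsConnectedSemisimple L ∧
    IsVirtualLieSubgroup E n φ S ∧
    (∀ g : G, ∃ r ∈ radical G, ∃ s ∈ S, g = r * s) ∧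
    IsCoveringMap (fun x : L => (QuotientGroup.mk (φ x) : G ⧸ radical G))

end LieGroup

/-! ### Connected subgroups and identity components of topological groups. -/

section ConnectedSubgroups

open Set Filter Topology
open scoped Pointwise commutatorElement

variable {G : Type*} [Group G] [TopologicalSpace G] [IsTopologicalGroup G]

/-! Let `R` be the radical, `N` the nilradical and `H ≥ N` a connected nilpotent subgroup. The
driving fact is `[G, R] ≤ N ≤ H`. Take `h = r s` in `H` with `r ∈ R` and `s ∈ S`. Since `[h, R] ⊆ H`
and `H` is nilpotent, `Ad h - 1` is nilpotent on the tangent directions of `R`. By a Lie–Kolchin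
argument `r` acts by scalars on the chief factors of the complexified adjoint representation, so on
those inside the span of these directions `s` is a scalar up to a nilpotent operator. The powers of
`s` stay in the compact group `S`, which forces `s` to be a scalar there.

For `g ∈ S` the commutator `[g, s]` is then trivial on these factors, hence unipotent on the span,
hence trivial on it by compactness again; so it centralizes `R`. The set of all `[g, s]` is
connected and contains `1`, while `C_S(R)` is normal in `G = R S`, so the hypothesis on `S` makes
its identity component trivial. Thus `s` is central in `S`. The centre of `S` is compact and, by
semisimplicity, totally disconnected, so the connected group `H ⊆ R Z(S)` lies in `R`. Now `[G, H] ≤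
N ≤ H` shows that `H` is normal, whence `H ≤ N`.

No Lie algebra or exponential map is used: `Ad t` is the derivative of conjugation in a chart, and
limits of rescaled coordinates replace the tangent space of a subgroup. The kernel of `Ad` is
central (`mem_center_of_adjoint_eq_one`), which identifies `R` and `N` with the identity components
of the groups acting by scalars, respectively trivially, on the chief factors
(`radical_eq_idComponent`, `nilradical_eq_idComponent`). Closedness of `R`, nilpotency of `N` and
`[G, R] ≤ N` all follow from this description. -/

theorem Subgroup.isConnected_closure_of_isPreconnected {X : Set G} (hX : IsPreconnected X)
    (h1 : (1 : G) ∈ X) : IsConnected (Subgroup.closure X : Set G) := by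
  set P := Subgroup.closure X
  have hXP : X ⊆ P := Subgroup.subset_closure
  have key : ∀ p ∈ P, p ∈ connectedComponentIn (P : Set G) 1 := by
    -- The translate `p x⁻¹ X` is connected, lies in `P` and joins `p` to `p x⁻¹ y`. Taking `x = 1`
    -- or `y = 1` handles right multiplication by a generator or by its inverse.
    have step : ∀ p ∈ P, ∀ x ∈ X, ∀ y ∈ X, p * x⁻¹ ∈ P →
        p * x⁻¹ * y ∈ connectedComponentIn (P : Set G) p := by
      intro p hp x hx y hy hpx
      have hpre : IsPreconnected ((fun z => p * x⁻¹ * z) '' X) :=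
        hX.image _ (by fun_prop)
      refine hpre.subset_connectedComponentIn ⟨x, hx, by group⟩ ?_ ⟨y, hy, rfl⟩
      rintro _ ⟨z, hz, rfl⟩
      exact P.mul_mem hpx (hXP hz)
    intro p hp
    induction hp using Subgroup.closure_induction_right with
    | one => exact mem_connectedComponentIn P.one_mem
    | mul_right p hp y hy ih =>
      have := step p hp 1 h1 y hy (by simpa using hp)
      rw [← connectedComponentIn_eq ih] at this
      simpa using this
    | mul_inv_cancel p hp y hy ih =>
      have := step p hp y hy 1 h1 (P.mul_mem hp (P.inv_mem (hXP hy)))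
      rw [← connectedComponentIn_eq ih] at this
      simpa using this
  have : (P : Set G) = connectedComponentIn (P : Set G) 1 :=
    Subset.antisymm (fun p hp => key p hp) (connectedComponentIn_subset _ _)
  refine ⟨⟨1, P.one_mem⟩, ?_⟩
  rw [this]
  exact isPreconnected_connectedComponentIn

theorem Subgroup.isConnected_sSup {𝒮 : Set (Subgroup G)}
    (h : ∀ H ∈ 𝒮, IsConnected (H : Set G)) : IsConnected ((sSup 𝒮 : Subgroup G) : Set G) := by
  have hpre : IsPreconnected ({1} ∪ ⋃ H ∈ 𝒮, (H : Set G)) := by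
    rw [← sUnion_image, ← sUnion_insert]
    refine isPreconnected_sUnion 1 _ ?_ ?_
    · rintro s (rfl | ⟨H, -, rfl⟩)
      · rfl
      · exact H.one_mem
    · rintro s (rfl | ⟨H, hH, rfl⟩)
      · exact isPreconnected_singleton
      · exact (h H hH).isPreconnected
  have hEq : sSup 𝒮 = Subgroup.closure ({1} ∪ ⋃ H ∈ 𝒮, (H : Set G)) := by
    apply le_antisymm
    · refine sSup_le fun H hH x hx => Subgroup.subset_closure (Or.inr ?_)
      exact mem_biUnion hH hx
    · rw [Subgroup.closure_le]
      rintro x (rfl | hx)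
      · exact Subgroup.one_mem _
      · obtain ⟨H, hH, hx⟩ := mem_iUnion₂.1 hx
        exact le_sSup hH hx
  rw [hEq]
  exact isConnected_closure_of_isPreconnected hpre (by simp)

theorem Subgroup.isConnected_commutator {H K : Subgroup G} (hH : IsConnected (H : Set G))
    (hK : IsConnected (K : Set G)) : IsConnected ((⁅H, K⁆ : Subgroup G) : Set G) := by
  have hpre : IsPreconnected {g : G | ∃ h ∈ H, ∃ k ∈ K, ⁅h, k⁆ = g} := by
    have := (hH.isPreconnected.prod hK.isPreconnected).image (fun p : G × G => ⁅p.1, p.2⁆)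
      (by simp only [commutatorElement_def]; fun_prop)
    convert this using 1
    ext g
    constructor
    · rintro ⟨h, hh, k, hk, rfl⟩
      exact ⟨(h, k), ⟨hh, hk⟩, rfl⟩
    · rintro ⟨⟨h, k⟩, ⟨hh, hk⟩, rfl⟩
      exact ⟨h, hh, k, hk, rfl⟩
  exact isConnected_closure_of_isPreconnected hpre ⟨1, H.one_mem, 1, K.one_mem, by simp⟩

/-- The largest connected subgroup contained in a subgroup `K` of a topological group. -/
def Subgroup.idComponent (K : Subgroup G) : Subgroup G :=
  sSup {H : Subgroup G | IsConnected (H : Set G) ∧ H ≤ K}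

theorem Subgroup.isConnected_idComponent (K : Subgroup G) :
    IsConnected (K.idComponent : Set G) :=
  isConnected_sSup fun _ hH => hH.1

set_option linter.unusedSectionVars false in
theorem Subgroup.idComponent_le (K : Subgroup G) : K.idComponent ≤ K :=
  sSup_le fun _ hH => hH.2

set_option linter.unusedSectionVars false in
theorem Subgroup.le_idComponent {H K : Subgroup G} (hH : IsConnected (H : Set G)) (h : H ≤ K) :
    H ≤ K.idComponent :=
  le_sSup ⟨hH, h⟩

/-- Allows sets in place of subgroups: conjugates, closures, translates and sets of commutators are
all placed in the identity component this way. -/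
theorem Subgroup.subset_idComponent {K : Subgroup G} {X : Set G} (hX : IsPreconnected X)
    (h1 : (1 : G) ∈ X) (h : X ⊆ K) : X ⊆ K.idComponent :=
  fun _ hx => le_idComponent (isConnected_closure_of_isPreconnected hX h1)
    ((closure_le K).2 h) (subset_closure hx)

theorem Subgroup.normal_idComponent (K : Subgroup G) [K.Normal] : K.idComponent.Normal := by
  refine ⟨fun n hn g => ?_⟩
  have himg : IsPreconnected ((fun x => g * x * g⁻¹) '' (K.idComponent : Set G)) :=
    K.isConnected_idComponent.isPreconnected.image _ (by fun_prop)
  refine subset_idComponent himg ⟨1, Subgroup.one_mem _, by simp⟩ ?_ ⟨n, hn, rfl⟩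
  rintro _ ⟨x, hx, rfl⟩
  exact Subgroup.Normal.conj_mem inferInstance _ (K.idComponent_le hx) g

theorem Subgroup.isClosed_idComponent {K : Subgroup G} (hK : IsClosed (K : Set G)) :
    IsClosed (K.idComponent : Set G) := by
  have h : _root_.closure (K.idComponent : Set G) ⊆ K.idComponent :=
    subset_idComponent K.isConnected_idComponent.isPreconnected.closure
      (_root_.subset_closure (Subgroup.one_mem _)) (closure_minimal K.idComponent_le hK)
  exact isClosed_of_closure_subset h

theorem Subgroup.totallyDisconnectedSpace_of_idComponent_eq_bot {K : Subgroup G}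
    (h : K.idComponent = ⊥) : TotallyDisconnectedSpace K := by
  refine ⟨fun X _ hX x hx y hy => ?_⟩
  have himg : IsPreconnected ((fun z : K => (x : G)⁻¹ * z) '' X) :=
    hX.image _ (by fun_prop)
  have hsub := subset_idComponent (K := K) himg ⟨x, hx, by simp⟩ (by
    rintro _ ⟨z, -, rfl⟩
    exact K.mul_mem (K.inv_mem x.2) z.2) ⟨y, hy, rfl⟩
  rw [h] at hsub
  have : (x : G)⁻¹ * y = 1 := by simpa using hsub
  exact Subtype.ext (inv_mul_eq_one.1 this)

/-- A connected subgroup is contained in every subgroup that contains a relative neighbourhood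
of the identity. -/
theorem Subgroup.le_of_eventually_mem {R K : Subgroup G} (hR : IsConnected (R : Set G))
    (h : ∀ᶠ x in 𝓝[(R : Set G)] 1, x ∈ K) : R ≤ K := by
  have : ConnectedSpace R := isConnected_iff_connectedSpace.1 hR
  have hopen : IsOpen ((K.subgroupOf R : Subgroup R) : Set R) := by
    refine Subgroup.isOpen_of_mem_nhds _ (g := 1) ?_
    have h' := (tendsto_nhdsWithin_iff.2 ⟨continuous_subtype_val.tendsto (1 : R),
      Eventually.of_forall fun x => x.2⟩).eventually (p := fun x => x ∈ K) h
    exact h'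
  have htop := IsClopen.eq_univ ⟨Subgroup.isClosed_of_isOpen _ hopen, hopen⟩ ⟨1, Subgroup.one_mem _⟩
  intro x hx
  have : (⟨x, hx⟩ : R) ∈ ((K.subgroupOf R : Subgroup R) : Set R) := by rw [htop]; trivial
  exact this

/-- If `H` is a connected subgroup of `R Z` where `R` is closed normal and `Z` is compact and
totally disconnected, then `H ≤ R`. -/
theorem Subgroup.le_of_subset_mul_totallyDisconnected [T2Space G] {H R Z : Subgroup G}
    (hH : IsConnected (H : Set G)) [R.Normal] (hR : IsClosed (R : Set G))
    (hZ : IsCompact (Z : Set G)) [TotallyDisconnectedSpace Z]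
    (h : ∀ x ∈ H, ∃ r ∈ R, ∃ z ∈ Z, x = r * z) : H ≤ R := by
  intro x hx
  by_contra hxR
  obtain ⟨r, hr, z, hz, rfl⟩ := h x hx
  have : CompactSpace Z := isCompact_iff_compactSpace.1 hZ
  -- An open subgroup `O ⊆ W` exists because the compact group `Z` is totally disconnected. The
  -- contradiction will be an `o ∈ O` with `r z o⁻¹ ∈ R`.
  let W : Set Z := {w | r * z * (w : G)⁻¹ ∉ R}
  have hW : IsOpen W := hR.isOpen_compl.preimage (by fun_prop : Continuous fun w : Z => r * z * (w : G)⁻¹)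
  have h1W : (1 : Z) ∈ W := by simpa [W] using hxR
  obtain ⟨V, hV, h1V, hVW⟩ := compact_exists_isClopen_in_isOpen hW h1W
  obtain ⟨O, hO⟩ := IsTopologicalGroup.exist_openSubgroup_sub_clopen_nhds_of_one hV h1V
  -- This is `(R ∩ Z) O`. Right invariance under `O` makes it clopen; left invariance under `R ∩ Z`
  -- makes `R O'` and `R O'ᶜ` disjoint. Both products are closed and together they cover `H`, so `H`
  -- stays in the one containing `1`.
  let O' : Set Z := {w | ∃ o ∈ O, (w : G) * (o : G)⁻¹ ∈ R}
  have hO'1 : ∀ w : Z, ∀ o ∈ O, w ∈ O' → w * o ∈ O' := by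
    rintro w o ho ⟨o', ho', hw⟩
    refine ⟨o' * o, O.mul_mem ho' ho, ?_⟩
    simpa [mul_assoc] using hw
  have hO'open : IsOpen O' := by
    have : O' = ⋃ w ∈ O', (fun y : Z => w⁻¹ * y) ⁻¹' (O : Set Z) := by
      ext y
      simp only [mem_iUnion, mem_preimage, SetLike.mem_coe, exists_prop]
      constructor
      · intro hy
        exact ⟨y, hy, by simp⟩
      · rintro ⟨w, hw, hy⟩
        simpa using hO'1 w _ hy hw
    rw [this]
    exact isOpen_biUnion fun w _ => O.isOpen.preimage (by fun_prop)
  have hO'closed : IsClosed O' := by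
    rw [← isOpen_compl_iff]
    have : O'ᶜ = ⋃ w ∈ O'ᶜ, (fun y : Z => w⁻¹ * y) ⁻¹' (O : Set Z) := by
      ext y
      simp only [mem_iUnion, mem_preimage, SetLike.mem_coe, exists_prop]
      constructor
      · intro hy
        exact ⟨y, hy, by simp⟩
      · rintro ⟨w, hw, hy⟩ hy'
        refine hw ?_
        simpa using hO'1 y _ (O.inv_mem hy) hy'
    rw [this]
    exact isOpen_biUnion fun w _ => O.isOpen.preimage (by fun_prop)
  have hcl : ∀ Y : Set Z, IsClosed Y → IsClosed ((R : Set G) * (((↑) : Z → G) '' Y)) := fun Y hY =>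
    hR.mul_right_of_isCompact (hY.isCompact.image continuous_subtype_val)
  have hdisj : ∀ y, y ∈ (R : Set G) * (((↑) : Z → G) '' O') → y ∉ (R : Set G) * (((↑) : Z → G) '' O'ᶜ) := by
    rintro _ ⟨a, ha, _, ⟨w, ⟨o, ho, hw⟩, rfl⟩, rfl⟩ ⟨b, hb, _, ⟨w', hw', rfl⟩, heq⟩
    refine hw' ⟨o, ho, ?_⟩
    have heq' : b * (w' : G) = a * w := heq
    have : (w' : G) * (o : G)⁻¹ = b⁻¹ * (a * (w * (o : G)⁻¹)) := by
      rw [← mul_assoc a, ← heq']; group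
    rw [this]
    exact R.mul_mem (R.inv_mem hb) (R.mul_mem ha hw)
  have hcover : (H : Set G) ⊆ (R : Set G) * (((↑) : Z → G) '' O') ∪ (R : Set G) * (((↑) : Z → G) '' O'ᶜ) := by
    intro y hy
    obtain ⟨a, ha, w, hw, rfl⟩ := h y hy
    by_cases hwO : (⟨w, hw⟩ : Z) ∈ O'
    · exact Or.inl ⟨a, ha, w, ⟨_, hwO, rfl⟩, rfl⟩
    · exact Or.inr ⟨a, ha, w, ⟨_, hwO, rfl⟩, rfl⟩
  have hsub : (H : Set G) ⊆ (R : Set G) * (((↑) : Z → G) '' O') := by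
    intro y hy
    refine (hcover hy).resolve_right fun hy' => ?_
    obtain ⟨w, -, hw, hw'⟩ := isPreconnected_closed_iff.1 hH.isPreconnected _ _
      (hcl O' hO'closed) (hcl _ hO'open.isClosed_compl) hcover
      ⟨1, H.one_mem, 1, R.one_mem, 1, ⟨1, ⟨1, O.one_mem, by simp⟩, rfl⟩, by simp⟩ ⟨y, hy, hy'⟩
    exact hdisj w hw hw'
  obtain ⟨a, ha, _, ⟨w, ⟨o, ho, hw⟩, rfl⟩, heq⟩ := hsub hx
  have heq' : a * (w : G) = r * z := heq
  refine hVW (hO ho) ?_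
  rw [← heq', mul_assoc]
  exact R.mul_mem ha hw

end ConnectedSubgroups

/-! ### Bounded operators and a Lie–Kolchin theorem. -/

section LinearActions

open Set Filter Topology Module
open scoped commutatorElement

theorem exists_dual_apply_eq_one {W : Type*} [AddCommGroup W] [Module ℂ W] {w : W} (hw : w ≠ 0) :
    ∃ f : W →ₗ[ℂ] ℂ, f w = 1 := by
  have : ¬ ∀ f : Dual ℂ W, f w = 0 := fun h => hw ((forall_dual_apply_eq_zero_iff ℂ w).1 h)
  push Not at this
  obtain ⟨f, hf⟩ := this
  exact ⟨(f w)⁻¹ • f, by simp [hf]⟩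

/-- A continuous function with finitely many values on a preconnected set is constant. -/
theorem IsPreconnected.eq_of_finite_values {X : Type*} [TopologicalSpace X] {S : Set X}
    (hS : IsPreconnected S) {φ : X → ℂ} (hφ : ContinuousOn φ S) {F : Set ℂ} (hF : F.Finite)
    (hmaps : MapsTo φ S F) {x y : X} (hx : x ∈ S) (hy : y ∈ S) : φ x = φ y :=
  hF.countable.isTotallyDisconnected _ hmaps.image_subset (hS.image φ hφ)
    (mem_image_of_mem φ hx) (mem_image_of_mem φ hy)

/-- Commuting operators on a nonzero complex vector space of finite dimension have a common
eigenvector. -/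
theorem exists_common_eigenvector {W : Type*} [AddCommGroup W] [Module ℂ W]
    [FiniteDimensional ℂ W] [Nontrivial W] (𝒮 : Set (End ℂ W))
    (hcomm : ∀ S ∈ 𝒮, ∀ T ∈ 𝒮, Commute S T) :
    ∃ w : W, w ≠ 0 ∧ ∀ T ∈ 𝒮, ∃ c : ℂ, T w = c • w := by
  -- On a minimal nonzero invariant subspace every operator of the family is a scalar, since its
  -- eigenspaces there are again invariant by commutativity.
  let 𝓜 : Set (Submodule ℂ W) := {M | M ≠ ⊥ ∧ ∀ T ∈ 𝒮, ∀ v ∈ M, T v ∈ M}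
  have hne : 𝓜.Nonempty := ⟨⊤, top_ne_bot, fun _ _ _ _ => trivial⟩
  obtain ⟨M, ⟨hM0, hM⟩, hmin⟩ := wellFounded_lt.has_min 𝓜 hne
  obtain ⟨w, hwM, hw0⟩ := M.exists_mem_ne_zero_of_ne_bot hM0
  refine ⟨w, hw0, fun T hT => ?_⟩
  have : Nontrivial M := ⟨⟨⟨w, hwM⟩, 0, fun h => hw0 (congrArg Subtype.val h)⟩⟩
  obtain ⟨c, hc⟩ := Module.End.exists_eigenvalue (T.restrict (hM T hT))
  obtain ⟨x, hx⟩ := hc.exists_hasEigenvector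
  refine ⟨c, ?_⟩
  have hM' : M ⊓ T.eigenspace c ∈ 𝓜 := by
    refine ⟨?_, fun S hS v hv => ⟨hM S hS v hv.1, ?_⟩⟩
    · intro h
      have hxm : (x : W) ∈ M ⊓ T.eigenspace c := by
        refine ⟨x.2, End.mem_eigenspace_iff.2 ?_⟩
        simpa using congrArg Subtype.val hx.apply_eq_smul
      rw [h, Submodule.mem_bot] at hxm
      exact hx.2 (Subtype.ext hxm)
    · have h1 : T v = c • v := End.mem_eigenspace_iff.1 hv.2
      have h2 : T (S v) = S (T v) := (LinearMap.congr_fun (hcomm T hT S hS).eq v)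
      refine End.mem_eigenspace_iff.2 ?_
      rw [h2, h1, map_smul]
  have hle : M ≤ M ⊓ T.eigenspace c := by
    by_contra hnot
    exact hmin _ hM' (lt_of_le_not_ge inf_le_left hnot)
  exact End.mem_eigenspace_iff.1 (hle hwM).2

/-- An operator with bounded matrix coefficients of powers, whose inverse has the same property,
is a scalar if it differs from a scalar by a nilpotent operator. -/
theorem eq_smul_one_of_isNilpotent_of_bounded {W : Type*} [AddCommGroup W] [Module ℂ W]
    (T T' : End ℂ W) (hTT' : T' * T = 1) {μ : ℂ} (hμ : μ ≠ 0) (hnil : IsNilpotent (T - μ • 1))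
    (hb : ∀ (v : W) (f : W →ₗ[ℂ] ℂ), ∃ C : ℝ, ∀ n : ℕ, ‖f ((T ^ n) v)‖ ≤ C)
    (hb' : ∀ (v : W) (f : W →ₗ[ℂ] ℂ), ∃ C : ℝ, ∀ n : ℕ, ‖f ((T' ^ n) v)‖ ≤ C) :
    T = μ • 1 := by
  set N := T - μ • 1 with hN
  by_contra hne
  have hN0 : N ≠ 0 := fun h => hne (sub_eq_zero.1 h)
  -- A Jordan block of size two: on `v` and `w = N v` the powers of `T` contain the term `(n + 1) μ
  -- ^ n w`. Boundedness of the inverse powers gives `1 ≤ ‖μ‖`, so this term is unbounded.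
  obtain ⟨v, hv1, hv2⟩ : ∃ v, N v ≠ 0 ∧ N (N v) = 0 := by
    classical
    have hfind := Nat.find_spec hnil
    set k := Nat.find hnil
    have hk2 : 2 ≤ k := by
      by_contra hlt
      have : k = 0 ∨ k = 1 := by omega
      rcases this with h | h
      · rw [h, pow_zero] at hfind
        exact hN0 (by rw [← mul_one N, hfind, mul_zero])
      · rw [h, pow_one] at hfind
        exact hN0 hfind
    obtain ⟨j, hj⟩ : ∃ j, k = j + 2 := ⟨k - 2, by omega⟩
    have hne' : N ^ (j + 1) ≠ 0 := Nat.find_min hnil (by change _ < k; omega)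
    obtain ⟨u, hu⟩ : ∃ u, (N ^ (j + 1)) u ≠ 0 := by
      by_contra hall
      push Not at hall
      exact hne' (LinearMap.ext hall)
    refine ⟨(N ^ j) u, ?_, ?_⟩
    · rwa [← Module.End.mul_apply, ← pow_succ']
    · have : N * (N * N ^ j) = 0 := by rw [← pow_succ', ← pow_succ', ← hfind, hj]
      exact LinearMap.congr_fun this u
  set w := N v with hw
  have hTv : T v = μ • v + w := by simp [hw, hN]
  have hTw : T w = μ • w := by
    have : N w = T w - μ • w := by simp [hN]
    rw [hv2] at this
    exact (sub_eq_zero.1 this.symm)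
  have hT'w : T' w = μ⁻¹ • w := by
    have h1 : T' (T w) = w := by rw [← Module.End.mul_apply, hTT']; rfl
    rw [hTw, map_smul] at h1
    rw [eq_inv_smul_iff₀ hμ, h1]
  have hTn : ∀ n : ℕ, (T ^ n) w = μ ^ n • w := by
    intro n
    induction n with
    | zero => simp
    | succ n ih => rw [pow_succ, Module.End.mul_apply, hTw, map_smul, ih, smul_smul, pow_succ']
  have hT'n : ∀ n : ℕ, (T' ^ n) w = (μ⁻¹) ^ n • w := by
    intro n
    induction n with
    | zero => simp
    | succ n ih => rw [pow_succ, Module.End.mul_apply, hT'w, map_smul, ih, smul_smul, pow_succ']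
  have hTvn : ∀ n : ℕ, (T ^ (n + 1)) v = μ ^ (n + 1) • v + ((n + 1 : ℂ) * μ ^ n) • w := by
    intro n
    induction n with
    | zero => simp [hTv]
    | succ n ih =>
      rw [pow_succ', Module.End.mul_apply, ih, map_add, map_smul, map_smul, hTv, hTw]
      push_cast
      module
  obtain ⟨f, hf⟩ := exists_dual_apply_eq_one hv1
  have hμ1 : 1 ≤ ‖μ‖ := by
    by_contra hlt
    push Not at hlt
    obtain ⟨C, hC⟩ := hb' w f
    have hgt : 1 < ‖μ⁻¹‖ := by
      rw [norm_inv]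
      exact one_lt_inv_iff₀.2 ⟨norm_pos_iff.2 hμ, hlt⟩
    obtain ⟨n, hn⟩ := pow_unbounded_of_one_lt C hgt
    have := hC n
    rw [hT'n, map_smul, hf, smul_eq_mul, mul_one, norm_pow] at this
    linarith
  obtain ⟨C, hC⟩ := hb v f
  obtain ⟨n, hn⟩ := exists_nat_gt (|C| + ‖μ * f v‖)
  have h1 := hC (n + 1)
  rw [hTvn, map_add, map_smul, map_smul, hf, smul_eq_mul, smul_eq_mul, mul_one] at h1
  have h2 : μ ^ (n + 1) * f v + ((n : ℂ) + 1) * μ ^ n = μ ^ n * (μ * f v + (n + 1)) := by ring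
  rw [h2, norm_mul, norm_pow] at h1
  have h3 : (n : ℝ) + 1 ≤ ‖μ * f v + (n + 1)‖ + ‖μ * f v‖ := by
    have h4 : ‖((n : ℂ) + 1)‖ = (n : ℝ) + 1 := by
      exact_mod_cast Complex.norm_natCast (n + 1)
    rw [← h4]
    calc ‖((n : ℂ) + 1)‖ = ‖(μ * f v + (n + 1)) - μ * f v‖ := by congr 1; ring
      _ ≤ _ := norm_sub_le _ _
  have h5 : (1 : ℝ) ≤ ‖μ‖ ^ n := one_le_pow₀ hμ1
  have h6 : ‖μ * f v + (n + 1)‖ ≤ ‖μ‖ ^ n * ‖μ * f v + (n + 1)‖ :=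
    le_mul_of_one_le_left (norm_nonneg _) h5
  have h7 := le_abs_self C
  linarith

variable {G : Type*} [Group G]

/-- Keeps the derived series inside `G`, so that inductions on the derived length can retain
normality in `G` and connectedness. -/
theorem Subgroup.iterate_commutator_eq_map_derivedSeries (H : Subgroup G) (k : ℕ) :
    (fun K : Subgroup G => ⁅K, K⁆)^[k] H = (derivedSeries H k).map H.subtype := by
  induction k with
  | zero => simp [← MonoidHom.range_eq_map]
  | succ k ih => rw [Function.iterate_succ_apply', ih, derivedSeries_succ, Subgroup.map_commutator]

theorem Subgroup.exists_iterate_commutator_eq_bot (H : Subgroup G) [h : Group.IsSolvable H] :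
    ∃ n : ℕ, (fun K : Subgroup G => ⁅K, K⁆)^[n] H = ⊥ := by
  obtain ⟨n, hn⟩ := h
  exact ⟨n, by rw [iterate_commutator_eq_map_derivedSeries, hn, Subgroup.map_bot]⟩

namespace Representation

variable {W : Type*} [AddCommGroup W] [Module ℂ W]

/-- All matrix coefficients of the representation are continuous. -/
def ContinuousCoeff [TopologicalSpace G] (ρ : Representation ℂ G W) : Prop :=
  ∀ (v : W) (f : W →ₗ[ℂ] ℂ), Continuous fun g => f (ρ g v)

theorem apply_inv_apply (ρ : Representation ℂ G W) (g : G) (v : W) : ρ g (ρ g⁻¹ v) = v := by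
  rw [← Module.End.mul_apply, ← map_mul, mul_inv_cancel, map_one, Module.End.one_apply]

theorem inv_apply_apply (ρ : Representation ℂ G W) (g : G) (v : W) : ρ g⁻¹ (ρ g v) = v := by
  rw [← Module.End.mul_apply, ← map_mul, inv_mul_cancel, map_one, Module.End.one_apply]

theorem det_apply_of_mem_commutator (ρ : Representation ℂ G W) {H K : Subgroup G} {g : G}
    (hg : g ∈ ⁅H, K⁆) : LinearMap.det (ρ g) = 1 := by
  let δ : G →* ℂˣ := ((LinearMap.det : End ℂ W →* ℂ).comp ρ).toHomUnits
  have hle : ⁅H, K⁆ ≤ δ.ker := by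
    rw [Subgroup.commutator_le]
    intro a _ b _
    rw [MonoidHom.mem_ker, map_commutatorElement, commutatorElement_eq_one_iff_mul_comm, mul_comm]
  exact congrArg Units.val (MonoidHom.mem_ker.1 (hle hg))

variable [TopologicalSpace G] [IsTopologicalGroup G] [ConnectedSpace G] [FiniteDimensional ℂ W]
  [Nontrivial W]

/-- A form of the Lie–Kolchin theorem: a connected normal solvable subgroup of a connected group
acts by scalars on each irreducible complex representation of finite dimension. -/
theorem exists_smul_one_of_isSolvable {ρ : Representation ℂ G W} (hρ : ρ.ContinuousCoeff)
    (hirr : ∀ M : Submodule ℂ W, (∀ g, ∀ v ∈ M, ρ g v ∈ M) → M = ⊥ ∨ M = ⊤)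
    (H : Subgroup G) [hN : H.Normal] (hconn : IsConnected (H : Set G)) [Group.IsSolvable H]
    {h : G} (hh : h ∈ H) : ∃ c : ℂˣ, ρ h = (c : ℂ) • 1 := by
  suffices hmain : ∀ (n : ℕ) (H : Subgroup G), H.Normal → IsConnected (H : Set G) →
      (fun K : Subgroup G => ⁅K, K⁆)^[n] H = ⊥ → ∀ h ∈ H, ∃ c : ℂ, ρ h = c • 1 by
    obtain ⟨n, hn⟩ := H.exists_iterate_commutator_eq_bot
    obtain ⟨c, hc⟩ := hmain n H hN hconn hn h hh
    have hc0 : c ≠ 0 := by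
      rintro rfl
      obtain ⟨w, hw⟩ := exists_ne (0 : W)
      have := ρ.inv_apply_apply h w
      rw [hc] at this
      simp at this
      exact hw this.symm
    exact ⟨Units.mk0 c hc0, hc⟩
  intro n
  induction n with
  | zero =>
    intro H _ _ hbot h hh
    rw [Function.iterate_zero, id] at hbot
    rw [hbot, Subgroup.mem_bot] at hh
    exact ⟨1, by rw [hh, map_one, one_smul]⟩
  | succ n ih =>
    intro H hN hconn hbot h hh
    have hconn' : IsConnected ((⁅H, H⁆ : Subgroup G) : Set G) :=
      Subgroup.isConnected_commutator hconn hconn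
    have hscal := ih ⁅H, H⁆ inferInstance hconn' hbot
    obtain ⟨w₀, hw₀⟩ := exists_ne (0 : W)
    obtain ⟨f₀, hf₀⟩ := exists_dual_apply_eq_one hw₀
    -- The derived group acts by scalars of determinant one, that is by roots of unity of order
    -- dividing the dimension; connectedness leaves only the value `1`. Hence `H` acts through
    -- commuting operators.
    have htriv : ∀ x ∈ ⁅H, H⁆, ρ x = 1 := by
      intro x hx
      have hfin : {z : ℂ | z ^ finrank ℂ W = 1}.Finite := by
        refine (Polynomial.nthRoots (finrank ℂ W) (1 : ℂ)).toFinset.finite_toSet.subset ?_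
        intro z hz
        simpa [Polynomial.mem_nthRoots finrank_pos] using hz
      have hval := hconn'.isPreconnected.eq_of_finite_values (hρ w₀ f₀).continuousOn hfin
        (fun y hy => by
          obtain ⟨c, hc⟩ := hscal y hy
          have hdet := ρ.det_apply_of_mem_commutator hy
          rw [hc, LinearMap.det_smul, map_one, mul_one] at hdet
          simpa [hc, hf₀] using hdet) hx (Subgroup.one_mem _)
      obtain ⟨c, hc⟩ := hscal x hx
      have : c = 1 := by simpa [hc, hf₀] using hval
      rw [hc, this, one_smul]
    obtain ⟨w, hw0, hw⟩ := exists_common_eigenvector (ρ '' (H : Set G)) (by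
      rintro _ ⟨a, ha, rfl⟩ _ ⟨b, hb, rfl⟩
      have hab : ρ ⁅a, b⁆ = 1 := htriv _ (Subgroup.commutator_mem_commutator ha hb)
      change ρ a * ρ b = ρ b * ρ a
      rw [← map_mul, ← map_mul]
      have : a * b = ⁅a, b⁆ * (b * a) := by rw [commutatorElement_def]; group
      rw [this, map_mul, hab, one_mul])
    obtain ⟨f, hf⟩ := exists_dual_apply_eq_one hw0
    obtain ⟨c, hc⟩ := hw _ ⟨h, hh, rfl⟩
    -- The eigenvalue of `g⁻¹ h g` on `w` is also the eigenvalue of `h` on `ρ g w`. It varies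
    -- continuously with `g` within the finite spectrum of `ρ h`, so it is constant on the connected
    -- group `G`.
    have hconj : ∀ g : G, ρ (g⁻¹ * h * g) w = c • w := by
      have heig : ∀ g : G, ρ (g⁻¹ * h * g) w = f (ρ (g⁻¹ * h * g) w) • w := by
        intro g
        obtain ⟨d, hd⟩ := hw _ ⟨g⁻¹ * h * g, by simpa using hN.conj_mem h hh g⁻¹, rfl⟩
        rw [hd, map_smul, hf, smul_eq_mul, mul_one]
      intro g
      have hval := (isPreconnected_univ (α := G)).eq_of_finite_values
        (φ := fun g => f (ρ (g⁻¹ * h * g) w))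
        (((hρ w f).comp (by fun_prop : Continuous fun g : G => g⁻¹ * h * g)).continuousOn)
        (Module.End.finite_hasEigenvalue (ρ h)) (fun g _ => by
          refine Module.End.hasEigenvalue_of_hasEigenvector (x := ρ g w)
            ⟨End.mem_eigenspace_iff.2 ?_, ?_⟩
          · rw [← map_smul, ← heig g, ← Module.End.mul_apply, ← Module.End.mul_apply, ← map_mul,
              ← map_mul]
            congr 2
            group
          · intro h0
            apply hw0
            rw [← ρ.inv_apply_apply g w, h0, map_zero]) (mem_univ g) (mem_univ 1)
      rw [heig g, show f (ρ (g⁻¹ * h * g) w) = _ from hval]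
      simp [hc, hf]
    refine ⟨c, ?_⟩
    let M : Submodule ℂ W := Submodule.span ℂ (range fun g => ρ g w)
    have hMinv : ∀ g, ∀ v ∈ M, ρ g v ∈ M := by
      intro g v hv
      have : M ≤ M.comap (ρ g) := by
        rw [Submodule.span_le]
        rintro _ ⟨x, rfl⟩
        refine Submodule.subset_span ⟨g * x, ?_⟩
        simp only [map_mul, Module.End.mul_apply]
      exact this hv
    have hMtop : M = ⊤ := by
      refine (hirr M hMinv).resolve_left fun hbot => hw0 ?_
      have : w ∈ M := Submodule.subset_span ⟨1, by simp⟩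
      rwa [hbot, Submodule.mem_bot] at this
    have hMle : M ≤ End.eigenspace (ρ h) c := by
      rw [Submodule.span_le]
      rintro _ ⟨g, rfl⟩
      refine End.mem_eigenspace_iff.2 ?_
      rw [← map_smul, ← hconj g, ← Module.End.mul_apply, ← Module.End.mul_apply, ← map_mul,
        ← map_mul]
      congr 2
      group
    ext v
    have hv : v ∈ M := by rw [hMtop]; trivial
    simpa using End.mem_eigenspace_iff.1 (hMle hv)

end Representation

end LinearActions

/-! ### Chief factors of a representation; elements acting on them by scalars or trivially. -/

section ChiefFactors

open Set Filter Topology Module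
open scoped commutatorElement

namespace Representation

variable {G : Type*} [Group G] {V : Type*} [AddCommGroup V] [Module ℂ V]
  {ρ : Representation ℂ G V}

instance [FiniteDimensional ℂ V] : WellFoundedLT (Subrepresentation ρ) :=
  StrictMono.wellFoundedLT (f := Subrepresentation.toSubmodule (ρ := ρ)) fun _ _ h => h

instance [FiniteDimensional ℂ V] : WellFoundedGT (Subrepresentation ρ) :=
  StrictMono.wellFoundedGT (f := Subrepresentation.toSubmodule (ρ := ρ)) fun _ _ h => h

/-- Induction along a chain of covering subrepresentations. -/
theorem subrepresentation_induction [FiniteDimensional ℂ V] {P : Subrepresentation ρ → Prop}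
    (hbot : P ⊥) (hcov : ∀ A B, A ⋖ B → P A → P B) (B : Subrepresentation ρ) : P B := by
  induction B using WellFoundedLT.induction with
  | ind B ih =>
    rcases eq_bot_or_bot_lt B with rfl | hB
    · exact hbot
    · obtain ⟨A, -, hA⟩ := exists_le_covBy_of_lt hB
      exact hcov A B hA (ih A hA.lt)

/-- The representation on the subquotient `B / (A ∩ B)`. -/
abbrev subquotient (A B : Subrepresentation ρ) :
    Representation ℂ G (B.toSubmodule ⧸ A.toSubmodule.comap B.toSubmodule.subtype) :=
  B.toRepresentation.quotient _ fun g _ hv => A.apply_mem_toSubmodule g hv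

theorem subquotient_mk (A B : Subrepresentation ρ) (g : G) (v : B.toSubmodule) :
    subquotient A B g (Submodule.Quotient.mk v) =
      Submodule.Quotient.mk (⟨ρ g v, B.apply_mem_toSubmodule g v.2⟩ : B.toSubmodule) := rfl

theorem subquotient_mk_eq_zero {A B : Subrepresentation ρ} {v : B.toSubmodule} :
    (Submodule.Quotient.mk v : B.toSubmodule ⧸ A.toSubmodule.comap B.toSubmodule.subtype) = 0 ↔
      (v : V) ∈ A.toSubmodule := by
  rw [Submodule.Quotient.mk_eq_zero]; rfl

theorem subquotient_eq_one_iff {A B : Subrepresentation ρ} {g : G} :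
    subquotient A B g = 1 ↔ ∀ v ∈ B.toSubmodule, ρ g v - v ∈ A.toSubmodule := by
  constructor
  · intro h v hv
    have := LinearMap.congr_fun h (Submodule.Quotient.mk ⟨v, hv⟩)
    rw [subquotient_mk, Module.End.one_apply, ← sub_eq_zero, ← Submodule.Quotient.mk_sub,
      subquotient_mk_eq_zero] at this
    exact this
  · intro h
    refine LinearMap.ext fun q => ?_
    obtain ⟨v, rfl⟩ := Submodule.Quotient.mk_surjective _ q
    rw [subquotient_mk, Module.End.one_apply, ← sub_eq_zero, ← Submodule.Quotient.mk_sub,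
      subquotient_mk_eq_zero]
    exact h v v.2

theorem nontrivial_subquotient {A B : Subrepresentation ρ} (h : A < B) :
    Nontrivial (B.toSubmodule ⧸ A.toSubmodule.comap B.toSubmodule.subtype) := by
  obtain ⟨v, hvB, hvA⟩ := SetLike.exists_of_lt (show A.toSubmodule < B.toSubmodule from h)
  exact ⟨⟨Submodule.Quotient.mk ⟨v, hvB⟩, 0, fun h0 => hvA (subquotient_mk_eq_zero.1 h0)⟩⟩

/-- An invariant subspace of the quotient pulls back to a subrepresentation between `A` and `B`. -/
theorem subquotient_irreducible {A B : Subrepresentation ρ} (h : A ⋖ B)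
    (M : Submodule ℂ (B.toSubmodule ⧸ A.toSubmodule.comap B.toSubmodule.subtype))
    (hM : ∀ g, ∀ v ∈ M, subquotient A B g v ∈ M) : M = ⊥ ∨ M = ⊤ := by
  let C : Subrepresentation ρ :=
    { toSubmodule := (M.comap (Submodule.mkQ _)).map B.toSubmodule.subtype
      apply_mem_toSubmodule := by
        rintro g _ ⟨v, hv, rfl⟩
        exact ⟨⟨ρ g v, B.apply_mem_toSubmodule g v.2⟩, hM g _ hv, rfl⟩ }
  have hAC : A ≤ C := by
    intro v hv
    have hvB : v ∈ B.toSubmodule := h.le hv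
    refine ⟨⟨v, hvB⟩, ?_, rfl⟩
    have : (Submodule.Quotient.mk ⟨v, hvB⟩ :
      B.toSubmodule ⧸ A.toSubmodule.comap B.toSubmodule.subtype) = 0 :=
      subquotient_mk_eq_zero.2 hv
    change (Submodule.Quotient.mk ⟨v, hvB⟩ :
      B.toSubmodule ⧸ A.toSubmodule.comap B.toSubmodule.subtype) ∈ M
    rw [this]
    exact M.zero_mem
  have hCB : C ≤ B := by
    rintro _ ⟨v, -, rfl⟩
    exact v.2
  rcases h.eq_or_eq hAC hCB with hC | hC
  · left
    rw [Submodule.eq_bot_iff]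
    intro q hq
    obtain ⟨v, rfl⟩ := Submodule.Quotient.mk_surjective _ q
    have : (v : V) ∈ C := ⟨v, hq, rfl⟩
    rw [hC] at this
    exact subquotient_mk_eq_zero.2 this
  · right
    rw [Submodule.eq_top_iff']
    intro q
    obtain ⟨v, rfl⟩ := Submodule.Quotient.mk_surjective _ q
    have : (v : V) ∈ C := by rw [hC]; exact v.2
    obtain ⟨v', hv', heq⟩ := this
    rwa [← Subtype.ext heq]

/-- A functional on the quotient lifts to `B` and extends to `V`, so coefficients of the subquotient
are coefficients of `ρ`. -/
theorem ContinuousCoeff.subquotient [TopologicalSpace G] (hρ : ρ.ContinuousCoeff)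
    (A B : Subrepresentation ρ) : (subquotient A B).ContinuousCoeff := by
  intro q f
  obtain ⟨v, rfl⟩ := Submodule.Quotient.mk_surjective _ q
  obtain ⟨f', hf'⟩ := LinearMap.exists_extend (f ∘ₗ Submodule.mkQ _)
  convert hρ v f' using 2 with g
  exact (LinearMap.congr_fun hf' ⟨ρ g v, B.apply_mem_toSubmodule g v.2⟩).symm

theorem ContinuousCoeff.toRepresentation [TopologicalSpace G] (hρ : ρ.ContinuousCoeff)
    (B : Subrepresentation ρ) : B.toRepresentation.ContinuousCoeff := by
  intro v f
  obtain ⟨f', hf'⟩ := LinearMap.exists_extend f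
  convert hρ v f' using 2 with g
  exact (LinearMap.congr_fun hf' ⟨ρ g v, B.apply_mem_toSubmodule g v.2⟩).symm

theorem ContinuousCoeff.exists_bound [TopologicalSpace G] (hρ : ρ.ContinuousCoeff)
    {K : Subgroup G} (hK : IsCompact (K : Set G)) {s : G} (hs : s ∈ K) (v : V) (f : V →ₗ[ℂ] ℂ) :
    ∃ C : ℝ, ∀ n : ℕ, ‖f (((ρ s) ^ n) v)‖ ≤ C := by
  obtain ⟨C, hC⟩ := hK.exists_bound_of_continuousOn (hρ v f).continuousOn
  exact ⟨C, fun n => by rw [← map_pow]; exact hC _ (K.pow_mem hs n)⟩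

/-- An element of a compact subgroup acts by a scalar if it acts by a scalar up to a nilpotent
operator. -/
theorem ContinuousCoeff.eq_smul_one [TopologicalSpace G] (hρ : ρ.ContinuousCoeff)
    {K : Subgroup G} (hK : IsCompact (K : Set G)) {s : G} (hs : s ∈ K) {μ : ℂ} (hμ : μ ≠ 0)
    (hnil : IsNilpotent (ρ s - μ • 1)) : ρ s = μ • 1 :=
  eq_smul_one_of_isNilpotent_of_bounded (ρ s) (ρ s⁻¹)
    (by rw [← map_mul, inv_mul_cancel, map_one]) hμ hnil
    (hρ.exists_bound hK hs) (hρ.exists_bound hK (K.inv_mem hs))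

theorem commutator_eq_one_of_smul_one (σ : Representation ℂ G V) {s : G} {c : ℂ}
    (hs : σ s = c • 1) (g : G) : σ ⁅g, s⁆ = 1 := by
  rw [commutatorElement_def, map_mul, map_mul, map_mul, hs, mul_smul_comm, mul_one, smul_mul_assoc,
    ← map_mul, mul_inv_cancel, map_one, smul_mul_assoc, one_mul]
  have : (c • 1 : End ℂ V) * σ s⁻¹ = 1 := by rw [← hs, ← map_mul, mul_inv_cancel, map_one]
  rwa [smul_mul_assoc, one_mul] at this

theorem eq_one_of_smul_one [Nontrivial V] (σ : Representation ℂ G V) {g : G} {c : ℂ}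
    (hc : σ g = c • 1) (hnil : IsNilpotent (σ g - 1)) : σ g = 1 := by
  obtain ⟨k, hk⟩ := hnil
  have h1 : σ g - 1 = (c - 1) • 1 := by rw [hc, sub_smul, one_smul]
  rw [h1, smul_pow, one_pow, smul_eq_zero] at hk
  have hc1 : c = 1 := sub_eq_zero.1 (eq_zero_of_pow_eq_zero (hk.resolve_right one_ne_zero))
  rw [hc, hc1, one_smul]

theorem isNilpotent_sub_smul_one (σ : Representation ℂ G V) {r s : G} {c : ℂˣ}
    (hc : σ r = (c : ℂ) • 1) (hnil : IsNilpotent (σ (r * s) - 1)) :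
    IsNilpotent (σ s - ((c⁻¹ : ℂˣ) : ℂ) • 1) := by
  have hsr : σ s = ((c⁻¹ : ℂˣ) : ℂ) • σ (r * s) := by
    rw [map_mul, hc, smul_mul_assoc, one_mul, smul_smul, Units.inv_mul, one_smul]
  rw [hsr, ← smul_sub]
  exact hnil.smul _

variable (ρ)

/-- The elements that act trivially on every chief factor of a representation. -/
def unipotentSubgroup : Subgroup G where
  carrier := {g | ∀ A B : Subrepresentation ρ, A ⋖ B → subquotient A B g = 1}
  one_mem' A B _ := map_one _
  mul_mem' ha hb A B h := by rw [map_mul, ha A B h, hb A B h, one_mul]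
  inv_mem' {a} ha A B h := by
    have : subquotient A B a * subquotient A B a⁻¹ = 1 := by rw [← map_mul, mul_inv_cancel, map_one]
    rwa [ha A B h, one_mul] at this

/-- The elements that act by a scalar on every chief factor of a representation. -/
def scalarSubgroup : Subgroup G where
  carrier := {g | ∀ A B : Subrepresentation ρ, A ⋖ B →
    ∃ c : ℂˣ, subquotient A B g = (c : ℂ) • 1}
  one_mem' A B _ := ⟨1, by rw [map_one, Units.val_one, one_smul]⟩
  mul_mem' ha hb A B h := by
    obtain ⟨c, hc⟩ := ha A B h
    obtain ⟨d, hd⟩ := hb A B h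
    exact ⟨c * d, by rw [map_mul, hc, hd, smul_mul_smul_comm, one_mul, Units.val_mul]⟩
  inv_mem' {a} ha A B h := by
    obtain ⟨c, hc⟩ := ha A B h
    refine ⟨c⁻¹, ?_⟩
    have : subquotient A B a * subquotient A B a⁻¹ = 1 := by rw [← map_mul, mul_inv_cancel, map_one]
    rw [hc, smul_mul_assoc, one_mul] at this
    rw [← this, smul_smul, Units.inv_mul, one_smul]

variable {ρ}

theorem mem_scalarSubgroup {g : G} : g ∈ scalarSubgroup ρ ↔
    ∀ A B : Subrepresentation ρ, A ⋖ B → ∃ c : ℂˣ, subquotient A B g = (c : ℂ) • 1 := Iff.rfl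

instance : (unipotentSubgroup ρ).Normal := by
  refine ⟨fun n hn g A B h => ?_⟩
  rw [map_mul, map_mul, hn A B h, mul_one, ← map_mul, mul_inv_cancel, map_one]

instance : (scalarSubgroup ρ).Normal := by
  refine ⟨fun n hn g A B h => ?_⟩
  obtain ⟨c, hc⟩ := hn A B h
  exact ⟨c, by rw [map_mul, map_mul, hc, mul_smul_comm, mul_one, smul_mul_assoc, ← map_mul,
    mul_inv_cancel, map_one]⟩

theorem commutator_mem_unipotentSubgroup {r : G} (hr : r ∈ scalarSubgroup ρ) (g : G) :
    ⁅g, r⁆ ∈ unipotentSubgroup ρ := by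
  intro A B h
  obtain ⟨c, hc⟩ := hr A B h
  exact commutator_eq_one_of_smul_one _ hc g

theorem isClosed_scalarSubgroup [TopologicalSpace G] (hρ : ρ.ContinuousCoeff) :
    IsClosed (scalarSubgroup ρ : Set G) := by
  have : (scalarSubgroup ρ : Set G) = ⋂ A : Subrepresentation ρ, ⋂ B : Subrepresentation ρ,
      ⋂ (_ : A ⋖ B), {g | ∃ c : ℂˣ, subquotient A B g = (c : ℂ) • 1} := by
    ext g
    simp [mem_scalarSubgroup]
  rw [this]
  refine isClosed_iInter fun A => isClosed_iInter fun B => isClosed_iInter fun h => ?_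
  have hσ := hρ.subquotient A B
  have := nontrivial_subquotient h.lt
  obtain ⟨w, hw⟩ :=
    exists_ne (0 : B.toSubmodule ⧸ A.toSubmodule.comap B.toSubmodule.subtype)
  obtain ⟨f, hf⟩ := exists_dual_apply_eq_one hw
  -- As `f w = 1`, the scalar can only be `f (σ g w)`. This turns the existence of a scalar into
  -- equations between continuous coefficients.
  have heq : {g | ∃ c : ℂˣ, subquotient A B g = (c : ℂ) • 1} =
      ⋂ q, ⋂ f' : _ →ₗ[ℂ] ℂ, {g | f' (subquotient A B g q) = f (subquotient A B g w) * f' q} := by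
    ext g
    simp only [mem_ofPred_eq, mem_iInter]
    constructor
    · rintro ⟨c, hc⟩ q f'
      simp [hc, hf]
    · intro hg
      have hg' : subquotient A B g = f (subquotient A B g w) • 1 := by
        refine LinearMap.ext fun q => ?_
        rw [← sub_eq_zero, ← forall_dual_apply_eq_zero_iff ℂ]
        intro f'
        rw [map_sub, hg q f']
        simp
      have hc0 : f (subquotient A B g w) ≠ 0 := by
        intro h0
        rw [h0, zero_smul] at hg'
        apply hw
        rw [← (subquotient A B).inv_apply_apply g w, hg', LinearMap.zero_apply, map_zero]
      exact ⟨Units.mk0 _ hc0, hg'⟩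
  rw [heq]
  exact isClosed_iInter fun q => isClosed_iInter fun f' =>
    isClosed_eq (hσ q f') ((hσ w f).mul continuous_const)

theorem le_scalarSubgroup [FiniteDimensional ℂ V] [TopologicalSpace G] [IsTopologicalGroup G]
    [ConnectedSpace G] (hρ : ρ.ContinuousCoeff) (H : Subgroup G) [H.Normal]
    (hconn : IsConnected (H : Set G)) [Group.IsSolvable H] : H ≤ scalarSubgroup ρ := by
  intro h hh A B hAB
  have := nontrivial_subquotient hAB.lt
  exact exists_smul_one_of_isSolvable (hρ.subquotient A B) (subquotient_irreducible hAB) H hconn hh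

theorem isNilpotent_subquotient_sub_one {A B : Subrepresentation ρ} {g : G} {k : ℕ}
    (hk : ∀ v ∈ B.toSubmodule, ((ρ g - 1) ^ k) v = 0) :
    IsNilpotent (subquotient A B g - 1) := by
  refine ⟨k, LinearMap.ext fun q => ?_⟩
  obtain ⟨v, rfl⟩ := Submodule.Quotient.mk_surjective _ q
  have hB : ∀ j : ℕ, ((ρ g - 1) ^ j) v ∈ B.toSubmodule := by
    intro j
    induction j with
    | zero => exact v.2
    | succ j ih =>
      rw [pow_succ', Module.End.mul_apply, LinearMap.sub_apply, Module.End.one_apply]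
      exact B.toSubmodule.sub_mem (B.apply_mem_toSubmodule g ih) ih
  have hmk : ∀ j : ℕ, ((subquotient A B g - 1) ^ j) (Submodule.Quotient.mk v) =
      Submodule.Quotient.mk ⟨((ρ g - 1) ^ j) v, hB j⟩ := by
    intro j
    induction j with
    | zero => rfl
    | succ j ih =>
      rw [pow_succ', Module.End.mul_apply, ih, LinearMap.sub_apply, Module.End.one_apply,
        subquotient_mk, ← Submodule.Quotient.mk_sub]
      refine congrArg Submodule.Quotient.mk (Subtype.ext ?_)
      change _ = ((ρ g - 1) ^ (j + 1)) (v : V)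
      rw [pow_succ', Module.End.mul_apply, LinearMap.sub_apply, Module.End.one_apply]
      rfl
  rw [hmk, LinearMap.zero_apply, subquotient_mk_eq_zero]
  change ((ρ g - 1) ^ k) v ∈ _
  rw [hk v v.2]
  exact A.toSubmodule.zero_mem

/-- An element acting by a scalar and unipotently on a chief factor acts trivially on it. -/
theorem subquotient_eq_one {A B : Subrepresentation ρ} (hAB : A ⋖ B) {g : G} {c : ℂ}
    (hc : subquotient A B g = c • 1) (hnil : IsNilpotent (subquotient A B g - 1)) :
    subquotient A B g = 1 := by
  have := nontrivial_subquotient hAB.lt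
  exact eq_one_of_smul_one _ hc hnil

/-- If a product `r s` acts unipotently on `B`, `r` acts by scalars on the chief factors and `s`
lies in a compact subgroup, then `s` acts by a scalar on the chief factor `B / A`. -/
theorem exists_subquotient_eq_smul_one [TopologicalSpace G] (hρ : ρ.ContinuousCoeff)
    {K : Subgroup G} (hK : IsCompact (K : Set G)) {r s : G} (hr : r ∈ scalarSubgroup ρ)
    (hs : s ∈ K) {A B : Subrepresentation ρ} (hAB : A ⋖ B) {k : ℕ}
    (hk : ∀ v ∈ B.toSubmodule, ((ρ (r * s) - 1) ^ k) v = 0) :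
    ∃ c : ℂ, subquotient A B s = c • 1 := by
  obtain ⟨c, hc⟩ := hr A B hAB
  refine ⟨(c⁻¹ : ℂˣ), (hρ.subquotient A B).eq_smul_one hK hs (Units.ne_zero _) ?_⟩
  exact isNilpotent_sub_smul_one _ hc (isNilpotent_subquotient_sub_one hk)

/-- An element of a compact subgroup acting trivially on all chief factors inside `C` acts
trivially on `C`. -/
theorem apply_eq_of_subquotient_eq_one [FiniteDimensional ℂ V] [TopologicalSpace G]
    (hρ : ρ.ContinuousCoeff) {K : Subgroup G} (hK : IsCompact (K : Set G)) {t : G} (ht : t ∈ K)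
    {C : Subrepresentation ρ}
    (hC : ∀ A B : Subrepresentation ρ, A ⋖ B → B ≤ C → subquotient A B t = 1) :
    ∀ v ∈ C.toSubmodule, ρ t v = v := by
  -- Triviality on the factors makes `t` unipotent on `C`; compactness then removes the nilpotent
  -- part.
  have key : ∀ B : Subrepresentation ρ, B ≤ C → ∃ k : ℕ, ∀ v ∈ B.toSubmodule,
      ((ρ t - 1) ^ k) v = 0 := by
    intro B
    induction B using subrepresentation_induction with
    | hbot => exact fun _ => ⟨0, fun v hv => hv⟩
    | hcov A B hAB ih =>
      intro hB
      obtain ⟨k, hk⟩ := ih (hAB.le.trans hB)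
      refine ⟨k + 1, fun v hv => ?_⟩
      rw [pow_succ, Module.End.mul_apply]
      exact hk _ (subquotient_eq_one_iff.1 (hC A B hAB hB) v hv)
  obtain ⟨k, hk⟩ := key C le_rfl
  intro v hv
  have hnil : IsNilpotent (C.toRepresentation t - (1 : ℂ) • 1) := by
    refine ⟨k, LinearMap.ext fun w => Subtype.ext ?_⟩
    have hpow : ∀ j : ℕ, ((((C.toRepresentation t - (1 : ℂ) • 1) ^ j) w : C.toSubmodule) : V) =
        ((ρ t - 1) ^ j) w := by
      intro j
      induction j with
      | zero => rfl
      | succ j ih =>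
        rw [pow_succ', pow_succ', Module.End.mul_apply, Module.End.mul_apply, ← ih, one_smul]
        rfl
    rw [hpow, hk w w.2]
    rfl
  have h1 := (hρ.toRepresentation C).eq_smul_one hK ht one_ne_zero hnil
  have h2 := LinearMap.congr_fun h1 ⟨v, hv⟩
  rw [one_smul] at h2
  exact congrArg Subtype.val h2

/-! ### Nilpotency of the unipotent subgroup and solvability of the scalar subgroup. -/

section Nilpotency

/-- The vectors killed by all `i`-fold products of operators `ρ u - 1`, for `u ∈ U`. -/
def unipotentFiltration (ρ : Representation ℂ G V) (U : Subgroup G) : ℕ → Submodule ℂ V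
  | 0 => ⊥
  | i + 1 => ⨅ u ∈ U, (unipotentFiltration ρ U i).comap (ρ u - 1)

theorem mem_unipotentFiltration_succ {U : Subgroup G} {i : ℕ} {v : V} :
    v ∈ unipotentFiltration ρ U (i + 1) ↔ ∀ u ∈ U, ρ u v - v ∈ unipotentFiltration ρ U i := by
  simp [unipotentFiltration]

theorem unipotentFiltration_le_succ (U : Subgroup G) (i : ℕ) :
    unipotentFiltration ρ U i ≤ unipotentFiltration ρ U (i + 1) := by
  induction i with
  | zero => exact bot_le
  | succ i ih =>
    intro v hv
    rw [mem_unipotentFiltration_succ] at hv ⊢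
    exact fun u hu => ih (hv u hu)

theorem apply_mem_unipotentFiltration {U : Subgroup G} {i : ℕ} {u : G} (hu : u ∈ U) {v : V}
    (hv : v ∈ unipotentFiltration ρ U i) : ρ u v ∈ unipotentFiltration ρ U i := by
  have := mem_unipotentFiltration_succ.1 (unipotentFiltration_le_succ U i hv) u hu
  simpa using Submodule.add_mem _ this hv

theorem exists_unipotentFiltration_eq_top [FiniteDimensional ℂ V] :
    ∃ k, unipotentFiltration ρ (unipotentSubgroup ρ) k = ⊤ := by
  have key : ∀ B : Subrepresentation ρ, ∃ k,
      B.toSubmodule ≤ unipotentFiltration ρ (unipotentSubgroup ρ) k := by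
    intro B
    induction B using subrepresentation_induction with
    | hbot => exact ⟨0, le_rfl⟩
    | hcov A B hAB ih =>
      obtain ⟨k, hk⟩ := ih
      refine ⟨k + 1, fun v hv => mem_unipotentFiltration_succ.2 fun u hu => ?_⟩
      exact hk (subquotient_eq_one_iff.1 (hu A B hAB) v hv)
  obtain ⟨k, hk⟩ := key ⊤
  exact ⟨k, top_le_iff.1 hk⟩

/-- Each commutator with `U` gains one step of the filtration. With `v = b a w`, the identity `([a,
b] - 1) v = (a - 1)(b - 1) w - (b - 1)(a - 1) w` reduces a commutator to its two entries. -/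
theorem apply_sub_mem_of_mem_lowerCentralSeries {U : Subgroup G} (j : ℕ) :
    ∀ x ∈ U.lowerCentralSeries j, ∀ (i : ℕ) (v : V),
      v ∈ unipotentFiltration ρ U (i + j + 1) → ρ x v - v ∈ unipotentFiltration ρ U i := by
  induction j with
  | zero => exact fun x hx i v hv => mem_unipotentFiltration_succ.1 hv x hx
  | succ j ih =>
    intro x hx
    rw [Subgroup.lowerCentralSeries_succ] at hx
    have hU : ⁅U.lowerCentralSeries j, U⁆ ≤ U := U.lowerCentralSeries_le_self (j + 1)
    induction hx using Subgroup.closure_induction with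
    | one => intro i v _; simp
    | mem x hx =>
      obtain ⟨a, ha, b, hbU, rfl⟩ := hx
      intro i v hv
      have haU : a ∈ U := U.lowerCentralSeries_le_self j ha
      have hb : ∀ (i : ℕ) (v : V), v ∈ unipotentFiltration ρ U (i + 1) →
        ρ b v - v ∈ unipotentFiltration ρ U i :=
        fun i v hv => mem_unipotentFiltration_succ.1 hv b hbU
      set w := ρ (b * a)⁻¹ v with hw
      have hwF : w ∈ unipotentFiltration ρ U (i + (j + 1) + 1) :=
        apply_mem_unipotentFiltration (U.inv_mem (U.mul_mem hbU haU)) hv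
      have hvw : v = ρ b (ρ a w) := by
        rw [← Module.End.mul_apply, ← map_mul, hw, apply_inv_apply]
      clear_value w
      subst hvw
      have hwF' : ∀ m, m = i + (j + 1) + 1 → w ∈ unipotentFiltration ρ U m := by
        rintro _ rfl
        exact hwF
      have h1 : ρ ⁅a, b⁆ (ρ b (ρ a w)) = ρ a (ρ b w) := by
        rw [← Module.End.mul_apply, ← Module.End.mul_apply, ← Module.End.mul_apply,
          ← map_mul, ← map_mul, ← map_mul, commutatorElement_def]
        congr 2
        group
      have h2 : ρ a (ρ b w - w) - (ρ b w - w) ∈ unipotentFiltration ρ U i :=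
        ih a ha i _ (hb _ _ (hwF' _ (by omega)))
      have h3 : ρ b (ρ a w - w) - (ρ a w - w) ∈ unipotentFiltration ρ U i :=
        hb i _ (ih a ha (i + 1) _ (hwF' _ (by omega)))
      rw [h1]
      convert Submodule.sub_mem _ h2 h3 using 1
      simp only [map_sub]
      abel
    | mul x y hxU _ hx hy =>
      intro i v hv
      have : ρ (x * y) v - v = ρ x (ρ y v - v) + (ρ x v - v) := by
        rw [map_mul, Module.End.mul_apply, map_sub]
        abel
      rw [this]
      exact Submodule.add_mem _ (apply_mem_unipotentFiltration (hU hxU) (hy i v hv)) (hx i v hv)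
    | inv x hxU hx =>
      intro i v hv
      have : ρ x⁻¹ v - v = - ρ x⁻¹ (ρ x v - v) := by
        rw [map_sub, inv_apply_apply]
        abel
      rw [this]
      exact Submodule.neg_mem _ (apply_mem_unipotentFiltration (U.inv_mem (hU hxU)) (hx i v hv))

/-- If only central elements act trivially, then the group of elements acting trivially on all
chief factors is nilpotent. -/
theorem isNilpotent_unipotentSubgroup [FiniteDimensional ℂ V]
    (hker : ∀ g, ρ g = 1 → g ∈ Subgroup.center G) :
    Group.IsNilpotent (unipotentSubgroup ρ) := by
  obtain ⟨k, hk⟩ := exists_unipotentFiltration_eq_top (ρ := ρ)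
  rw [Subgroup.isNilpotent_iff_lowerCentralSeries]
  -- The `k`-th term acts trivially, which only makes it central; one more commutator is needed.
  refine ⟨k + 1, ?_⟩
  rw [Subgroup.lowerCentralSeries_succ, eq_bot_iff, Subgroup.commutator_le]
  intro x hx y _
  have htriv : ρ x = 1 := by
    refine LinearMap.ext fun v => ?_
    have hv : v ∈ unipotentFiltration ρ (unipotentSubgroup ρ) (0 + k + 1) := by
      rw [zero_add]
      exact unipotentFiltration_le_succ _ _ (by rw [hk]; trivial)
    exact sub_eq_zero.1 (apply_sub_mem_of_mem_lowerCentralSeries k x hx 0 v hv)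
  rw [Subgroup.mem_bot, commutatorElement_eq_one_iff_mul_comm]
  exact (Subgroup.mem_center_iff.1 (hker x htriv) y).symm

/-- A unipotent element acting by scalars on chief factors acts trivially on them. -/
theorem mem_unipotentSubgroup_of_isNilpotent {g : G} (hg : g ∈ scalarSubgroup ρ)
    (hnil : IsNilpotent (ρ g - 1)) : g ∈ unipotentSubgroup ρ := by
  intro A B hAB
  obtain ⟨c, hc⟩ := hg A B hAB
  obtain ⟨k, hk⟩ := hnil
  exact subquotient_eq_one hAB hc
    (isNilpotent_subquotient_sub_one (k := k) fun v _ => by rw [hk]; rfl)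

/-- Scalars commute, so the derived subgroup is trivial on every chief factor and lies in the
nilpotent unipotent subgroup. -/
theorem isSolvable_scalarSubgroup [FiniteDimensional ℂ V]
    (hker : ∀ g, ρ g = 1 → g ∈ Subgroup.center G) :
    Group.IsSolvable (scalarSubgroup ρ) := by
  have hU := isNilpotent_unipotentSubgroup hker
  obtain ⟨n, hn⟩ := (unipotentSubgroup ρ).exists_iterate_commutator_eq_bot
  have hmono : ∀ (k : ℕ) (H K : Subgroup G), H ≤ K →
      (fun K : Subgroup G => ⁅K, K⁆)^[k] H ≤ (fun K : Subgroup G => ⁅K, K⁆)^[k] K := by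
    intro k
    induction k with
    | zero => exact fun H K h => h
    | succ k ih => exact fun H K h => ih _ _ (Subgroup.commutator_mono h h)
  have hle : ⁅scalarSubgroup ρ, scalarSubgroup ρ⁆ ≤ unipotentSubgroup ρ :=
    Subgroup.commutator_le.2 fun g _ r hr => commutator_mem_unipotentSubgroup hr g
  refine ⟨n + 1, ?_⟩
  rw [← Subgroup.map_eq_bot_iff_of_injective _ (scalarSubgroup ρ).subtype_injective,
    ← Subgroup.iterate_commutator_eq_map_derivedSeries, eq_bot_iff, ← hn]
  exact hmono n _ _ hle

end Nilpotency

end Representation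

end ChiefFactors

namespace LieGroup

set_option linter.unusedSectionVars false

/-! ### First-order calculus at the identity and the adjoint representation. -/

section LocalCoordinates

open Set Filter Topology Asymptotics

variable (E : Type*) [NormedAddCommGroup E] [NormedSpace ℝ E]
  {G : Type*} [Group G] [TopologicalSpace G] [ChartedSpace E G]

/-- Coordinates of a Lie group near the identity, centred at `0`. -/
noncomputable def logChart (x : G) : E :=
  extChartAt 𝓘(ℝ, E) (1 : G) x - extChartAt 𝓘(ℝ, E) (1 : G) 1

@[simp] theorem logChart_one : logChart E (1 : G) = 0 := sub_self _

theorem map_logChart_nhds : map (logChart E) (𝓝 (1 : G)) = 𝓝 0 := by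
  have h1 : (logChart E : G → E) =
      (fun y => y - extChartAt 𝓘(ℝ, E) (1 : G) 1) ∘ extChartAt 𝓘(ℝ, E) (1 : G) := rfl
  rw [h1, ← Filter.map_map, map_extChartAt_nhds_of_boundaryless]
  simp

theorem eventually_eq_one_of_logChart_eq_zero :
    ∀ᶠ x in 𝓝 (1 : G), logChart E x = 0 → x = 1 := by
  filter_upwards [extChartAt_source_mem_nhds (I := 𝓘(ℝ, E)) (1 : G)] with x hx h
  exact (extChartAt 𝓘(ℝ, E) (1 : G)).injOn hx (mem_extChartAt_source (1 : G)) (sub_eq_zero.1 h)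

/-- A sequence in the group whose coordinates are `v / (n + 1)`. -/
theorem exists_seq_logChart (v : E) : ∃ x : ℕ → G, Tendsto x atTop (𝓝 1) ∧
    Tendsto (fun n : ℕ => ((n : ℝ) + 1) • logChart E (x n)) atTop (𝓝 v) := by
  set κ := extChartAt 𝓘(ℝ, E) (1 : G) with hκ
  have hlim : Tendsto (fun n : ℕ => κ 1 + (1 / ((n : ℝ) + 1)) • v) atTop (𝓝 (κ 1)) := by
    have h := (tendsto_one_div_add_atTop_nhds_zero_nat (𝕜 := ℝ)).smul_const v
    simpa using tendsto_const_nhds.add h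
  refine ⟨fun n => κ.symm (κ 1 + (1 / ((n : ℝ) + 1)) • v), ?_, ?_⟩
  · have h := (continuousAt_extChartAt_symm (I := 𝓘(ℝ, E)) (1 : G)).tendsto.comp hlim
    rwa [extChartAt_to_inv] at h
  · refine tendsto_const_nhds.congr' ?_
    filter_upwards [hlim.eventually_mem (extChartAt_target_mem_nhds (I := 𝓘(ℝ, E)) (1 : G))]
      with n hn
    have : (n : ℝ) + 1 ≠ 0 := by positivity
    change v = ((n : ℝ) + 1) • (κ (κ.symm _) - κ 1)
    rw [κ.right_inv hn, add_sub_cancel_left, smul_smul, mul_one_div_cancel this, one_smul]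

variable [LieGroup 𝓘(ℝ, E) ∞ G]

theorem contMDiffAt_extChartAt_symm_self (t : G) :
    ContMDiffAt 𝓘(ℝ, E) 𝓘(ℝ, E) ∞ (extChartAt 𝓘(ℝ, E) t).symm (extChartAt 𝓘(ℝ, E) t t) :=
  (contMDiffOn_extChartAt_symm t).contMDiffAt (extChartAt_target_mem_nhds t)

/-- The multiplication in coordinates. -/
noncomputable def mulChart (p : E × E) : E :=
  extChartAt 𝓘(ℝ, E) (1 : G)
    ((extChartAt 𝓘(ℝ, E) (1 : G)).symm p.1 * (extChartAt 𝓘(ℝ, E) (1 : G)).symm p.2)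

theorem contDiffAt_mulChart :
    ContDiffAt ℝ ∞ (mulChart E (G := G))
      (extChartAt 𝓘(ℝ, E) (1 : G) 1, extChartAt 𝓘(ℝ, E) (1 : G) 1) := by
  rw [← contMDiffAt_iff_contDiffAt]
  set κ := extChartAt 𝓘(ℝ, E) (1 : G) with hκ
  have hs := contMDiffAt_extChartAt_symm_self E (1 : G)
  have h1 : ContMDiffAt 𝓘(ℝ, E × E) 𝓘(ℝ, E) ∞ (κ.symm ∘ Prod.fst) (κ 1, κ 1) :=
    ContMDiffAt.comp (κ 1, κ 1) hs contDiff_fst.contMDiff.contMDiffAt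
  have h2 : ContMDiffAt 𝓘(ℝ, E × E) 𝓘(ℝ, E) ∞ (κ.symm ∘ Prod.snd) (κ 1, κ 1) :=
    ContMDiffAt.comp (κ 1, κ 1) hs contDiff_snd.contMDiff.contMDiffAt
  have h3 := h1.mul h2
  refine ContMDiffAt.comp (κ 1, κ 1) (g := κ) ?_ h3
  have h4 : κ.symm (κ 1) = 1 := extChartAt_to_inv (I := 𝓘(ℝ, E)) (1 : G)
  change ContMDiffAt _ _ _ κ (κ.symm (κ 1) * κ.symm (κ 1))
  rw [h4, mul_one]
  exact contMDiffAt_extChartAt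

/-- Conjugation by an element close to `t`, in coordinates. -/
noncomputable def conjChart (t : G) (p : E × E) : E :=
  extChartAt 𝓘(ℝ, E) (1 : G) ((extChartAt 𝓘(ℝ, E) t).symm p.1 *
    (extChartAt 𝓘(ℝ, E) (1 : G)).symm p.2 * ((extChartAt 𝓘(ℝ, E) t).symm p.1)⁻¹)

theorem contDiffAt_conjChart (t : G) :
    ContDiffAt ℝ ∞ (conjChart E t)
      (extChartAt 𝓘(ℝ, E) t t, extChartAt 𝓘(ℝ, E) (1 : G) 1) := by
  rw [← contMDiffAt_iff_contDiffAt]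
  set κ := extChartAt 𝓘(ℝ, E) (1 : G) with hκ
  set χ := extChartAt 𝓘(ℝ, E) t with hχ
  have h1 : ContMDiffAt 𝓘(ℝ, E × E) 𝓘(ℝ, E) ∞ (χ.symm ∘ Prod.fst) (χ t, κ 1) :=
    ContMDiffAt.comp (χ t, κ 1) (contMDiffAt_extChartAt_symm_self E t)
      contDiff_fst.contMDiff.contMDiffAt
  have h2 : ContMDiffAt 𝓘(ℝ, E × E) 𝓘(ℝ, E) ∞ (κ.symm ∘ Prod.snd) (χ t, κ 1) :=
    ContMDiffAt.comp (χ t, κ 1) (contMDiffAt_extChartAt_symm_self E (1 : G))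
      contDiff_snd.contMDiff.contMDiffAt
  have h3 := (h1.mul h2).mul h1.inv
  refine ContMDiffAt.comp (χ t, κ 1) (g := κ) ?_ h3
  have h4 : χ.symm (χ t) = t := extChartAt_to_inv (I := 𝓘(ℝ, E)) t
  have h5 : κ.symm (κ 1) = 1 := extChartAt_to_inv (I := 𝓘(ℝ, E)) (1 : G)
  change ContMDiffAt _ _ _ κ (χ.symm (χ t) * κ.symm (κ 1) * (χ.symm (χ t))⁻¹)
  rw [h4, h5, mul_one, mul_inv_cancel]
  exact contMDiffAt_extChartAt

/-- The multiplication agrees with the addition to first order at the identity. -/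
theorem eventually_norm_logChart_mul {ε : ℝ} (hε : 0 < ε) :
    ∀ᶠ p : G × G in 𝓝 (1, 1), ‖logChart E (p.1 * p.2) - logChart E p.1 - logChart E p.2‖ ≤
      ε * (‖logChart E p.1‖ + ‖logChart E p.2‖) := by
  set κ := extChartAt 𝓘(ℝ, E) (1 : G) with hκ
  have hd := (contDiffAt_mulChart E (G := G)).hasStrictFDerivAt (by simp)
  set D := fderiv ℝ (mulChart E (G := G)) (κ 1, κ 1) with hD
  have htgt := extChartAt_target_mem_nhds (I := 𝓘(ℝ, E)) (1 : G)
  have h1κ : κ.symm (κ 1) = 1 := extChartAt_to_inv (I := 𝓘(ℝ, E)) (1 : G)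
  have hfst : ∀ x : E, D (x, 0) = x := by
    have h1 : HasFDerivAt (fun x : E => mulChart E (G := G) (x, κ 1))
        (D.comp (ContinuousLinearMap.inl ℝ E E)) (κ 1) :=
      hd.hasFDerivAt.comp (f := fun x : E => (x, κ 1)) (κ 1)
        (hasFDerivAt_prodMk_left (𝕜 := ℝ) (κ 1) (κ 1))
    have h2 : HasFDerivAt (fun x : E => mulChart E (G := G) (x, κ 1))
        (ContinuousLinearMap.id ℝ E) (κ 1) := by
      refine (hasFDerivAt_id (κ 1)).congr_of_eventuallyEq ?_
      filter_upwards [htgt] with x hx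
      change κ (κ.symm x * κ.symm (κ 1)) = x
      rw [h1κ, mul_one]
      exact κ.right_inv hx
    intro x
    simpa using congrArg (fun T => T x) (h1.unique h2)
  have hsnd : ∀ x : E, D (0, x) = x := by
    have h1 : HasFDerivAt (fun x : E => mulChart E (G := G) (κ 1, x))
        (D.comp (ContinuousLinearMap.inr ℝ E E)) (κ 1) :=
      hd.hasFDerivAt.comp (f := fun x : E => (κ 1, x)) (κ 1)
        (hasFDerivAt_prodMk_right (𝕜 := ℝ) (κ 1) (κ 1))
    have h2 : HasFDerivAt (fun x : E => mulChart E (G := G) (κ 1, x))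
        (ContinuousLinearMap.id ℝ E) (κ 1) := by
      refine (hasFDerivAt_id (κ 1)).congr_of_eventuallyEq ?_
      filter_upwards [htgt] with x hx
      change κ (κ.symm (κ 1) * κ.symm x) = x
      rw [h1κ, one_mul]
      exact κ.right_inv hx
    intro x
    simpa using congrArg (fun T => T x) (h1.unique h2)
  have hDadd : ∀ x y : E, D (x, y) = x + y := by
    intro x y
    have : ((x, y) : E × E) = (x, 0) + (0, y) := by simp
    rw [this, map_add, hfst, hsnd]
  have ho := (isLittleO_iff.1 hd.hasFDerivAt.isLittleO) hε
  have htends : Tendsto (fun p : G × G => (κ p.1, κ p.2)) (𝓝 (1, 1)) (𝓝 (κ 1, κ 1)) := by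
    have hc := continuousAt_extChartAt (I := 𝓘(ℝ, E)) (1 : G)
    rw [nhds_prod_eq, nhds_prod_eq]
    exact hc.tendsto.prodMap hc.tendsto
  have hsrc := extChartAt_source_mem_nhds (I := 𝓘(ℝ, E)) (1 : G)
  have hsrc2 : ∀ᶠ p : G × G in 𝓝 (1, 1), p.1 ∈ κ.source ∧ p.2 ∈ κ.source := by
    rw [nhds_prod_eq]
    exact prod_mem_prod hsrc hsrc
  filter_upwards [htends.eventually ho, hsrc2] with p hp hps
  have h1 : mulChart E (G := G) (κ p.1, κ p.2) = κ (p.1 * p.2) := by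
    rw [mulChart, κ.left_inv hps.1, κ.left_inv hps.2]
  have h2 : mulChart E (G := G) (κ 1, κ 1) = κ 1 := by
    simp [mulChart, hκ]
  rw [h1, h2, Prod.mk_sub_mk, hDadd] at hp
  have h3 : logChart E (p.1 * p.2) - logChart E p.1 - logChart E p.2 =
      κ (p.1 * p.2) - κ 1 - (κ p.1 - κ 1 + (κ p.2 - κ 1)) := by
    simp only [logChart, ← hκ]; abel
  rw [h3]
  refine hp.trans (mul_le_mul_of_nonneg_left ?_ hε.le)
  rw [Prod.norm_mk]
  exact max_le_add_of_nonneg (norm_nonneg _) (norm_nonneg _)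

/-- Strict differentiability of conjugation in both variables is applied to two points with the same
conjugating element. The estimate is therefore uniform for conjugators near `t`, which yields
continuity of `adjoint` and the later compactness arguments. -/
theorem exists_conj_derivative (t : G) : ∃ A : E →L[ℝ] E, ∀ ε : ℝ, 0 < ε →
    ∀ᶠ p : G × G in 𝓝 (t, 1),
      ‖logChart E (p.1 * p.2 * p.1⁻¹) - A (logChart E p.2)‖ ≤ ε * ‖logChart E p.2‖ := by
  set κ := extChartAt 𝓘(ℝ, E) (1 : G) with hκ
  set χ := extChartAt 𝓘(ℝ, E) t with hχ
  have hd := (contDiffAt_conjChart E t).hasStrictFDerivAt (by simp)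
  set D := fderiv ℝ (conjChart E t) (χ t, κ 1) with hD
  refine ⟨D.comp (ContinuousLinearMap.inr ℝ E E), fun ε hε => ?_⟩
  have ho := (isLittleO_iff.1 hd.isLittleO) hε
  have hcκ := continuousAt_extChartAt (I := 𝓘(ℝ, E)) (1 : G)
  have hcχ := continuousAt_extChartAt (I := 𝓘(ℝ, E)) t
  have htends : Tendsto (fun p : G × G => ((χ p.1, κ p.2), (χ p.1, κ 1))) (𝓝 (t, 1))
      (𝓝 ((χ t, κ 1), (χ t, κ 1))) := by
    have h1 : Tendsto (fun p : G × G => χ p.1) (𝓝 (t, 1)) (𝓝 (χ t)) :=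
      hcχ.tendsto.comp continuous_fst.continuousAt.tendsto
    have h2 : Tendsto (fun p : G × G => κ p.2) (𝓝 (t, 1)) (𝓝 (κ 1)) :=
      hcκ.tendsto.comp (continuous_snd.tendsto (t, (1 : G)))
    exact (h1.prodMk_nhds h2).prodMk_nhds (h1.prodMk_nhds tendsto_const_nhds)
  have hsrc : ∀ᶠ p : G × G in 𝓝 (t, 1), p.1 ∈ χ.source ∧ p.2 ∈ κ.source := by
    rw [nhds_prod_eq]
    exact prod_mem_prod (extChartAt_source_mem_nhds (I := 𝓘(ℝ, E)) t)
      (extChartAt_source_mem_nhds (I := 𝓘(ℝ, E)) (1 : G))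
  filter_upwards [htends.eventually ho, hsrc] with p hp hps
  have h1 : conjChart E t (χ p.1, κ p.2) = κ (p.1 * p.2 * p.1⁻¹) := by
    rw [conjChart, χ.left_inv hps.1, κ.left_inv hps.2]
  have h2 : conjChart E t (χ p.1, κ 1) = κ 1 := by
    simp [conjChart, hκ]
  simp only [h1, h2, Prod.mk_sub_mk, sub_self] at hp
  rw [Prod.norm_mk, norm_zero, max_eq_right (norm_nonneg _)] at hp
  exact hp

/-- The adjoint representation, as a map to operators on the model space. -/
noncomputable def adjoint (t : G) : E →L[ℝ] E := (exists_conj_derivative E t).choose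

theorem eventually_norm_logChart_conj (t : G) {ε : ℝ} (hε : 0 < ε) :
    ∀ᶠ p : G × G in 𝓝 (t, 1),
      ‖logChart E (p.1 * p.2 * p.1⁻¹) - adjoint E t (logChart E p.2)‖ ≤ ε * ‖logChart E p.2‖ :=
  (exists_conj_derivative E t).choose_spec ε hε

variable {E}

/-- `f` fixes the identity in the limit and has derivative `L` there, in logarithmic coordinates. -/
structure HasDerivAtOne (f : G → G) (L : E →L[ℝ] E) : Prop where
  tendsto : Tendsto f (𝓝 1) (𝓝 1)
  isLittleO : (fun x => logChart E (f x) - L (logChart E x)) =o[𝓝 1] fun x => logChart E x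

namespace HasDerivAtOne

variable {f g : G → G} {L L' : E →L[ℝ] E}

theorem isBigO (hf : HasDerivAtOne f L) :
    (fun x => logChart E (f x)) =O[𝓝 1] fun x => logChart E x := by
  have h := hf.isLittleO.isBigO.add (L.isBigO_comp (fun x : G => logChart E x) (𝓝 1))
  simpa using h

theorem id : HasDerivAtOne (fun x : G => x) (1 : E →L[ℝ] E) :=
  ⟨tendsto_id, by simp⟩

theorem unique (hf : HasDerivAtOne f L) (hf' : HasDerivAtOne f L') : L = L' := by
  have h : (fun x : G => (L - L') (logChart E x)) =o[𝓝 1] fun x => logChart E x := by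
    have := hf'.isLittleO.sub hf.isLittleO
    refine this.congr_left fun x => ?_
    simp only [sub_apply]
    abel
  have h0 : ‖L - L'‖ ≤ 0 := by
    refine le_of_forall_pos_le_add fun ε hε => ?_
    rw [zero_add]
    refine ContinuousLinearMap.opNorm_le_of_nhds_zero hε.le ?_
    rw [← map_logChart_nhds E (G := G), eventually_map]
    exact isLittleO_iff.1 h hε
  exact sub_eq_zero.1 (norm_le_zero_iff.1 h0)

theorem comp (hf : HasDerivAtOne f L) (hg : HasDerivAtOne g L') :
    HasDerivAtOne (fun x => f (g x)) (L * L') := by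
  refine ⟨hf.tendsto.comp hg.tendsto, ?_⟩
  have h1 := (hf.isLittleO.comp_tendsto hg.tendsto).trans_isBigO hg.isBigO
  have h2 := (L.isBigO_comp _ _).trans_isLittleO hg.isLittleO
  refine (h1.add h2).congr_left fun x => ?_
  simp

theorem mul [IsTopologicalGroup G] (hf : HasDerivAtOne f L) (hg : HasDerivAtOne g L') :
    HasDerivAtOne (fun x => f x * g x) (L + L') := by
  refine ⟨by simpa using hf.tendsto.mul hg.tendsto, ?_⟩
  have h1 : (fun x => logChart E (f x * g x) - logChart E (f x) - logChart E (g x)) =o[𝓝 1]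
      fun x => ‖logChart E (f x)‖ + ‖logChart E (g x)‖ := by
    rw [isLittleO_iff]
    intro ε hε
    filter_upwards [(hf.tendsto.prodMk_nhds hg.tendsto).eventually
      (eventually_norm_logChart_mul E hε)] with x hx
    rwa [Real.norm_of_nonneg (by positivity)]
  have h2 := h1.trans_isBigO (hf.isBigO.norm_left.add hg.isBigO.norm_left)
  refine ((h2.add hf.isLittleO).add hg.isLittleO).congr_left fun x => ?_
  simp only [add_apply]
  abel

theorem inv [IsTopologicalGroup G] : HasDerivAtOne (fun x : G => x⁻¹) (-1 : E →L[ℝ] E) := by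
  have htend : Tendsto (fun x : G => x⁻¹) (𝓝 1) (𝓝 1) := by
    simpa using (continuous_inv (G := G)).tendsto 1
  have hmul : ∀ ε : ℝ, 0 < ε → ∀ᶠ x : G in 𝓝 1, ‖logChart E x⁻¹ + logChart E x‖ ≤
      ε * (‖logChart E x‖ + ‖logChart E x⁻¹‖) := by
    intro ε hε
    filter_upwards [((tendsto_id (x := 𝓝 (1 : G))).prodMk_nhds htend).eventually
      (eventually_norm_logChart_mul E hε)] with x hx
    have h1 : logChart E (x * x⁻¹) - logChart E x - logChart E x⁻¹ =
        - (logChart E x⁻¹ + logChart E x) := by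
      rw [mul_inv_cancel, logChart_one]; abel
    simpa only [_root_.id, h1, norm_neg] using hx
  refine ⟨htend, isLittleO_iff.2 fun ε hε => ?_⟩
  -- The bound `1 / 2` gives `‖log x⁻¹‖ ≤ 3 ‖log x‖`, so the two norms add up to at most `4 ‖log
  -- x‖`, which `ε / 4` absorbs.
  filter_upwards [hmul (min (1 / 2) (ε / 4)) (by positivity)] with x hx
  have h1 : logChart E x⁻¹ - (-1 : E →L[ℝ] E) (logChart E x) = logChart E x⁻¹ + logChart E x := by
    simp
  rw [h1]
  have h2 : ‖logChart E x⁻¹‖ ≤ ‖logChart E x⁻¹ + logChart E x‖ + ‖logChart E x‖ := by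
    simpa using norm_sub_le (logChart E x⁻¹ + logChart E x) (logChart E x)
  have h3 : min (1 / 2) (ε / 4) * (‖logChart E x‖ + ‖logChart E x⁻¹‖) ≤
      1 / 2 * (‖logChart E x‖ + ‖logChart E x⁻¹‖) :=
    mul_le_mul_of_nonneg_right (min_le_left _ _) (by positivity)
  have h4 : min (1 / 2) (ε / 4) * (‖logChart E x‖ + ‖logChart E x⁻¹‖) ≤
      ε / 4 * (‖logChart E x‖ + ‖logChart E x⁻¹‖) :=
    mul_le_mul_of_nonneg_right (min_le_right _ _) (by positivity)
  have h5 : ‖logChart E x⁻¹‖ ≤ 3 * ‖logChart E x‖ := by linarith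
  have h6 : ε / 4 * (‖logChart E x‖ + ‖logChart E x⁻¹‖) ≤ ε / 4 * (4 * ‖logChart E x‖) :=
    mul_le_mul_of_nonneg_left (by linarith) (by positivity)
  linarith

theorem conj [IsTopologicalGroup G] (t : G) :
    HasDerivAtOne (fun x => t * x * t⁻¹) (adjoint E t) := by
  refine ⟨?_, isLittleO_iff.2 fun ε hε => ?_⟩
  · have : Continuous fun x : G => t * x * t⁻¹ := by fun_prop
    simpa using this.tendsto 1
  · exact ((eventually_norm_logChart_conj E t hε).curry_nhds).self_of_nhds

open scoped commutatorElement in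
theorem commutator [IsTopologicalGroup G] (t : G) :
    HasDerivAtOne (fun x : G => ⁅t, x⁆) (adjoint E t - 1) := by
  simpa [commutatorElement_def, sub_eq_add_neg] using (conj (E := E) t).mul inv

theorem iterate (hf : HasDerivAtOne f L) (k : ℕ) : HasDerivAtOne (f^[k]) (L ^ k) := by
  induction k with
  | zero => exact id
  | succ k ih =>
    rw [Function.iterate_succ', pow_succ']
    exact hf.comp ih

end HasDerivAtOne

variable [IsTopologicalGroup G]

theorem adjoint_one : adjoint E (1 : G) = 1 :=
  (HasDerivAtOne.conj (1 : G)).unique (by simpa using HasDerivAtOne.id)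

theorem adjoint_mul (s t : G) : adjoint E (s * t) = adjoint E s * adjoint E t := by
  refine (HasDerivAtOne.conj (s * t)).unique ?_
  simpa [mul_assoc] using (HasDerivAtOne.conj (E := E) s).comp (HasDerivAtOne.conj t)

theorem continuous_adjoint : Continuous (adjoint E : G → E →L[ℝ] E) := by
  rw [continuous_iff_continuousAt]
  intro t₀
  rw [ContinuousAt, tendsto_iff_norm_sub_tendsto_zero, Metric.tendsto_nhds]
  intro ε hε
  filter_upwards [(eventually_norm_logChart_conj E t₀
    (by positivity : 0 < ε / 4)).curry_nhds] with t ht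
  have hle : ‖adjoint E t - adjoint E t₀‖ ≤ ε / 2 := by
    refine ContinuousLinearMap.opNorm_le_of_nhds_zero (by positivity) ?_
    rw [← map_logChart_nhds E (G := G), eventually_map]
    filter_upwards [ht, (eventually_norm_logChart_conj E t
      (by positivity : 0 < ε / 4)).curry_nhds.self_of_nhds] with x h1 h2
    have h3 : (adjoint E t - adjoint E t₀) (logChart E x) =
        (logChart E (t * x * t⁻¹) - adjoint E t₀ (logChart E x)) -
        (logChart E (t * x * t⁻¹) - adjoint E t (logChart E x)) := by
      simp
    rw [h3]
    refine (norm_sub_le _ _).trans ?_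
    linarith
  rw [Real.dist_0_eq_abs, abs_of_nonneg (norm_nonneg _)]
  linarith

end LocalCoordinates


/-! ### The kernel of the adjoint representation is central. -/

section KernelOfAdjoint

open Set Filter Topology Asymptotics

/-- A function whose derivative is bounded by a multiple of its value vanishes near its zeros. -/
theorem eventually_eq_zero_of_norm_fderiv_le {E F : Type*} [NormedAddCommGroup E]
    [NormedSpace ℝ E] [ProperSpace E] [NormedAddCommGroup F] [NormedSpace ℝ F] {f : E → F}
    {a : E} {C : ℝ} (ha : f a = 0)
    (hf : ∀ᶠ x in 𝓝 a, DifferentiableAt ℝ f x ∧ ‖fderiv ℝ f x‖ ≤ C * ‖f x‖) :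
    ∀ᶠ x in 𝓝 a, f x = 0 := by
  obtain ⟨r, hr, hball⟩ := Metric.eventually_nhds_iff_ball.1 hf
  -- On a ball this small, the mean value inequality bounds the maximum of `‖f‖` by half of itself.
  set s := min (r / 2) (1 / (2 * (|C| + 1))) with hs
  have hs0 : 0 < s := by positivity
  have hsub : Metric.closedBall a s ⊆ Metric.ball a r :=
    Metric.closedBall_subset_ball ((min_le_left _ _).trans_lt (by linarith))
  have hcont : ContinuousOn (fun x => ‖f x‖) (Metric.closedBall a s) := fun x hx =>
    (hball x (hsub hx)).1.continuousAt.norm.continuousWithinAt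
  obtain ⟨y, hy, hmax⟩ := (isCompact_closedBall a s).exists_isMaxOn
    ⟨a, Metric.mem_closedBall_self hs0.le⟩ hcont
  have hC : ∀ x ∈ Metric.closedBall a s, ‖fderiv ℝ f x‖ ≤ |C| * ‖f y‖ := fun x hx =>
    (hball x (hsub hx)).2.trans (mul_le_mul (le_abs_self C) (hmax hx) (norm_nonneg _)
      (abs_nonneg _))
  have hle := (convex_closedBall a s).norm_image_sub_le_of_norm_fderiv_le
    (fun x hx => (hball x (hsub hx)).1) hC (Metric.mem_closedBall_self hs0.le) hy
  rw [ha, sub_zero] at hle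
  have hys : ‖y - a‖ ≤ s := by rwa [← dist_eq_norm]
  have h1 : |C| * s ≤ 1 / 2 := by
    have h2 : s ≤ 1 / (2 * (|C| + 1)) := min_le_right _ _
    have h3 : (0 : ℝ) < |C| + 1 := by positivity
    calc |C| * s ≤ (|C| + 1) * (1 / (2 * (|C| + 1))) :=
          mul_le_mul (by linarith) h2 hs0.le h3.le
      _ = 1 / 2 := by field_simp
  have h4 : ‖f y‖ ≤ 1 / 2 * ‖f y‖ := by
    calc ‖f y‖ ≤ |C| * ‖f y‖ * ‖y - a‖ := hle
      _ ≤ |C| * ‖f y‖ * s := mul_le_mul_of_nonneg_left hys (by positivity)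
      _ = (|C| * s) * ‖f y‖ := by ring
      _ ≤ 1 / 2 * ‖f y‖ := mul_le_mul_of_nonneg_right h1 (norm_nonneg _)
  have h5 : ‖f y‖ = 0 := by linarith [norm_nonneg (f y)]
  filter_upwards [Metric.closedBall_mem_nhds a hs0] with x hx
  have h6 : ‖f x‖ ≤ ‖f y‖ := hmax hx
  rw [h5] at h6
  exact norm_le_zero_iff.1 h6

variable {E : Type*} [NormedAddCommGroup E] [NormedSpace ℝ E]
  {G : Type*} [Group G] [TopologicalSpace G] [ChartedSpace E G] [LieGroup 𝓘(ℝ, E) ∞ G]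
  [IsTopologicalGroup G]

/-- Conjugation by `g`, in coordinates at the identity. -/
noncomputable def conjChartOne (E : Type*) [NormedAddCommGroup E] [NormedSpace ℝ E] {G : Type*}
    [Group G] [TopologicalSpace G] [ChartedSpace E G] (g : G) (x : E) : E :=
  extChartAt 𝓘(ℝ, E) (1 : G) (g * (extChartAt 𝓘(ℝ, E) (1 : G)).symm x * g⁻¹)

theorem contDiffAt_conjChartOne (g : G) :
    ContDiffAt ℝ ∞ (conjChartOne E g) (extChartAt 𝓘(ℝ, E) (1 : G) 1) := by
  have h := (contDiffAt_conjChart E g).comp (extChartAt 𝓘(ℝ, E) (1 : G) 1)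
    (f := fun x : E => (extChartAt 𝓘(ℝ, E) g g, x)) (contDiffAt_const.prodMk contDiffAt_id)
  refine h.congr_of_eventuallyEq (Eventually.of_forall fun x => ?_)
  have h4 : (extChartAt 𝓘(ℝ, E) g).symm (extChartAt 𝓘(ℝ, E) g g) = g :=
    extChartAt_to_inv (I := 𝓘(ℝ, E)) g
  simp only [conjChartOne, conjChart, Function.comp_apply, h4]

theorem conjChartOne_self (g : G) :
    conjChartOne E g (extChartAt 𝓘(ℝ, E) (1 : G) 1) = extChartAt 𝓘(ℝ, E) (1 : G) 1 := by
  have h4 : (extChartAt 𝓘(ℝ, E) (1 : G)).symm (extChartAt 𝓘(ℝ, E) (1 : G) 1) = 1 :=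
    extChartAt_to_inv (I := 𝓘(ℝ, E)) (1 : G)
  rw [conjChartOne, h4, mul_one, mul_inv_cancel]

theorem hasFDerivAt_conjChartOne (g : G) :
    HasFDerivAt (conjChartOne E g) (adjoint E g) (extChartAt 𝓘(ℝ, E) (1 : G) 1) := by
  set κ := extChartAt 𝓘(ℝ, E) (1 : G) with hκ
  have hsymm : Tendsto κ.symm (𝓝 (κ 1)) (𝓝 1) := by
    have h := (continuousAt_extChartAt_symm (I := 𝓘(ℝ, E)) (1 : G)).tendsto
    rwa [extChartAt_to_inv] at h
  rw [hasFDerivAt_iff_isLittleO]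
  refine ((HasDerivAtOne.conj (E := E) g).isLittleO.comp_tendsto hsymm).congr' ?_ ?_
  · filter_upwards [extChartAt_target_mem_nhds (I := 𝓘(ℝ, E)) (1 : G)] with x hx
    have hx' : κ (κ.symm x) = x := κ.right_inv hx
    have h1 : logChart E (κ.symm x) = x - κ 1 := by rw [logChart, ← hκ, hx']
    have h2 : conjChartOne E g (κ 1) = κ 1 := conjChartOne_self g
    simp only [Function.comp_apply, h1, h2]
    rfl
  · filter_upwards [extChartAt_target_mem_nhds (I := 𝓘(ℝ, E)) (1 : G)] with x hx
    have hx' : κ (κ.symm x) = x := κ.right_inv hx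
    simp only [Function.comp_apply, logChart, ← hκ, hx']

theorem eventually_conjChartOne_mulChart (g : G) :
    ∀ᶠ x in 𝓝 (extChartAt 𝓘(ℝ, E) (1 : G) 1), ∀ᶠ y in 𝓝 (extChartAt 𝓘(ℝ, E) (1 : G) 1),
      conjChartOne E g (mulChart E (G := G) (x, y)) =
        mulChart E (G := G) (conjChartOne E g x, conjChartOne E g y) := by
  set κ := extChartAt 𝓘(ℝ, E) (1 : G) with hκ
  have hsymm : Tendsto κ.symm (𝓝 (κ 1)) (𝓝 1) := by
    have h := (continuousAt_extChartAt_symm (I := 𝓘(ℝ, E)) (1 : G)).tendsto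
    rwa [extChartAt_to_inv] at h
  have hsrc := extChartAt_source_mem_nhds (I := 𝓘(ℝ, E)) (1 : G)
  have hmul : ∀ᶠ p : E × E in 𝓝 (κ 1, κ 1), κ.symm p.1 * κ.symm p.2 ∈ κ.source := by
    have h1 : Tendsto (fun p : E × E => κ.symm p.1 * κ.symm p.2) (𝓝 (κ 1, κ 1)) (𝓝 1) := by
      rw [nhds_prod_eq]
      simpa using (hsymm.comp tendsto_fst).mul (hsymm.comp tendsto_snd)
    exact h1.eventually_mem hsrc
  have hconj : ∀ᶠ x in 𝓝 (κ 1), g * κ.symm x * g⁻¹ ∈ κ.source := by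
    have h1 : Tendsto (fun x => g * κ.symm x * g⁻¹) (𝓝 (κ 1)) (𝓝 1) := by
      simpa using (hsymm.const_mul g).mul_const g⁻¹
    exact h1.eventually_mem hsrc
  filter_upwards [hmul.curry_nhds, hconj] with x hx hxg
  filter_upwards [hx, hconj] with y hy hyg
  simp only [conjChartOne, mulChart, ← hκ]
  rw [κ.left_inv hy, κ.left_inv hxg, κ.left_inv hyg]
  congr 1
  group

/-- Conjugation `φ` is a local homomorphism, so its derivative at `1` determines its derivative
nearby through left translations. The resulting differential equation forces `φ = id` by a
Grönwall-type estimate. -/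
theorem eventually_conj_eq_of_adjoint_eq_one [FiniteDimensional ℝ E] {g : G}
    (hg : adjoint E g = 1) : ∀ᶠ x in 𝓝 (1 : G), g * x * g⁻¹ = x := by
  have : ProperSpace E := FiniteDimensional.proper_real E
  set κ := extChartAt 𝓘(ℝ, E) (1 : G) with hκ
  set φ := conjChartOne E g with hφdef
  set m := mulChart E (G := G) with hm
  have hφ0 : φ (κ 1) = κ 1 := conjChartOne_self g
  have hφsmooth : ∀ᶠ x in 𝓝 (κ 1), DifferentiableAt ℝ φ x := by
    filter_upwards [((contDiffAt_conjChartOne (E := E) g).of_le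
      (m := 1) (by norm_cast)).eventually (by simp)] with x hx
    exact hx.differentiableAt (by simp)
  have hφcont : Tendsto φ (𝓝 (κ 1)) (𝓝 (κ 1)) := by
    have := (contDiffAt_conjChartOne (E := E) g).continuousAt.tendsto
    rwa [conjChartOne_self] at this
  have hmsmooth : ContDiffAt ℝ 2 m (κ 1, κ 1) :=
    (contDiffAt_mulChart E (G := G)).of_le (by norm_cast)
  have hpair : ContDiffAt ℝ 1 (fun x : E => (x, κ 1)) (κ 1) :=
    contDiffAt_id.prodMk contDiffAt_const
  have hmdiff : ∀ᶠ x in 𝓝 (κ 1), DifferentiableAt ℝ m (x, κ 1) := by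
    filter_upwards [hpair.continuousAt.eventually (hmsmooth.eventually (by simp))] with x hx
    exact hx.differentiableAt (by simp)
  let M : E → E →L[ℝ] E := fun x => (fderiv ℝ m (x, κ 1)).comp (ContinuousLinearMap.inr ℝ E E)
  have hMsmooth : ContDiffAt ℝ 1 M (κ 1) := by
    have h1 : ContDiffAt ℝ 1 (fderiv ℝ m) (κ 1, κ 1) :=
      hmsmooth.fderiv_right (by norm_num)
    have h2 : ContDiffAt ℝ 1 (fun x : E => fderiv ℝ m (x, κ 1)) (κ 1) :=
      ContDiffAt.comp (κ 1) (f := fun x : E => (x, κ 1)) h1 hpair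
    exact h2.clm_comp contDiffAt_const
  have hMder : ∀ᶠ x in 𝓝 (κ 1), HasFDerivAt (fun y => m (x, y)) (M x) (κ 1) := by
    filter_upwards [hmdiff] with x hx
    exact hx.hasFDerivAt.comp (f := fun y : E => (x, y)) (κ 1)
      (hasFDerivAt_prodMk_right (𝕜 := ℝ) x (κ 1))
  have h1κ : κ.symm (κ 1) = 1 := extChartAt_to_inv (I := 𝓘(ℝ, E)) (1 : G)
  have htgt := extChartAt_target_mem_nhds (I := 𝓘(ℝ, E)) (1 : G)
  have hmr : ∀ᶠ x in 𝓝 (κ 1), m (x, κ 1) = x := by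
    filter_upwards [htgt] with x hx
    change κ (κ.symm x * κ.symm (κ 1)) = x
    rw [h1κ, mul_one]
    exact κ.right_inv hx
  have hM0 : M (κ 1) = 1 := by
    refine hMder.self_of_nhds.unique ((hasFDerivAt_id (κ 1)).congr_of_eventuallyEq ?_)
    filter_upwards [htgt] with x hx
    change κ (κ.symm (κ 1) * κ.symm x) = x
    rw [h1κ, one_mul]
    exact κ.right_inv hx
  obtain ⟨K, t, ht, hLip⟩ := hMsmooth.exists_lipschitzOnWith
  have hMnear : ∀ᶠ x in 𝓝 (κ 1), ‖1 - M x‖ ≤ 1 / 2 := by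
    have h1 : Tendsto (fun x => ‖1 - M x‖) (𝓝 (κ 1)) (𝓝 0) := by
      have h2 := (hMsmooth.continuousAt.tendsto.const_sub (1 : E →L[ℝ] E)).norm
      rwa [hM0, sub_self, norm_zero] at h2
    exact (h1.eventually (gt_mem_nhds (by norm_num : (0 : ℝ) < 1 / 2))).mono fun x hx => le_of_lt hx
  -- Differentiate `φ (m (x, y)) = m (φ x, φ y)` in `y` at the identity, with `Ad g = 1`; `M x` is
  -- the derivative of left translation.
  have hint : ∀ᶠ x in 𝓝 (κ 1), (fderiv ℝ φ x) * M x = M (φ x) := by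
    filter_upwards [eventually_conjChartOne_mulChart (E := E) g, hφsmooth, hMder, hmr,
      hφcont.eventually hMder] with x hx hdx hMx hmx hMφx
    have h1 : HasFDerivAt (fun y => φ (m (x, y))) ((fderiv ℝ φ x).comp (M x)) (κ 1) := by
      refine HasFDerivAt.comp (g := φ) (κ 1) ?_ hMx
      rw [hmx]
      exact hdx.hasFDerivAt
    have h2 : HasFDerivAt (fun y => m (φ x, φ y)) ((M (φ x)).comp (adjoint E g)) (κ 1) := by
      refine HasFDerivAt.comp (g := fun y => m (φ x, y)) (κ 1) ?_ (hasFDerivAt_conjChartOne g)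
      rw [hφ0]
      exact hMφx
    have h3 := h1.unique (h2.congr_of_eventuallyEq hx)
    rw [hg] at h3
    exact h3
  have hzero : ∀ᶠ x in 𝓝 (κ 1), φ x - x = 0 := by
    refine eventually_eq_zero_of_norm_fderiv_le (f := fun x => φ x - x) (C := 2 * K)
      (by rw [hφ0, sub_self]) ?_
    filter_upwards [hφsmooth, hint, hMnear, ht, hφcont.eventually_mem ht] with x hdx hx hn hxt hφt
    have hder : fderiv ℝ (fun x => φ x - x) x = fderiv ℝ φ x - 1 :=
      (hdx.hasFDerivAt.sub (hasFDerivAt_id x)).fderiv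
    refine ⟨hdx.sub differentiableAt_id, ?_⟩
    rw [hder]
    set D := fderiv ℝ φ x - 1 with hD
    -- The last term is at most `‖D‖ / 2`, and `M` is Lipschitz; hence `‖D‖ ≤ 2 K ‖φ x - x‖`.
    have h1 : D = (M (φ x) - M x) + D * (1 - M x) := by
      rw [← hx, hD]
      noncomm_ring
    have h2 : ‖M (φ x) - M x‖ ≤ K * ‖φ x - x‖ := by
      have := hLip.dist_le_mul _ hφt _ hxt
      rwa [dist_eq_norm, dist_eq_norm] at this
    have h3 : ‖D * (1 - M x)‖ ≤ ‖D‖ * (1 / 2) :=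
      (norm_mul_le _ _).trans (mul_le_mul_of_nonneg_left hn (norm_nonneg _))
    have h4 : ‖D‖ ≤ ‖M (φ x) - M x‖ + ‖D * (1 - M x)‖ := by
      conv_lhs => rw [h1]
      exact norm_add_le _ _
    linarith
  have hcκ := (continuousAt_extChartAt (I := 𝓘(ℝ, E)) (1 : G)).tendsto
  have hsrc := extChartAt_source_mem_nhds (I := 𝓘(ℝ, E)) (1 : G)
  have hconj : ∀ᶠ x in 𝓝 (1 : G), g * x * g⁻¹ ∈ κ.source :=
    (HasDerivAtOne.conj (E := E) g).tendsto.eventually_mem hsrc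
  filter_upwards [hcκ.eventually hzero, hsrc, hconj] with x hx hxs hgs
  have h1 : φ (κ x) = κ (g * x * g⁻¹) := by
    simp only [hφdef, conjChartOne, ← hκ]
    rw [κ.left_inv hxs]
  refine κ.injOn hgs hxs ?_
  rw [← h1]
  exact sub_eq_zero.1 hx

/-- The kernel of the adjoint representation of a connected Lie group is central. -/
theorem mem_center_of_adjoint_eq_one [FiniteDimensional ℝ E] [ConnectedSpace G] {g : G}
    (hg : adjoint E g = 1) : g ∈ Subgroup.center G := by
  have htop : IsConnected ((⊤ : Subgroup G) : Set G) := by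
    rw [Subgroup.coe_top]
    exact isConnected_univ
  have hle : ⊤ ≤ Subgroup.centralizer {g} := by
    refine Subgroup.le_of_eventually_mem htop ?_
    filter_upwards [nhdsWithin_le_nhds (eventually_conj_eq_of_adjoint_eq_one hg)] with x hx
    rw [Subgroup.mem_centralizer_singleton_iff]
    exact (mul_inv_eq_iff_eq_mul.1 hx).symm
  rw [Subgroup.mem_center_iff]
  intro x
  exact Subgroup.mem_centralizer_singleton_iff.1 (hle (Subgroup.mem_top x))

end KernelOfAdjoint

/-! ### Tangent directions of subsets, and actions of compact subgroups on them. -/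

section TangentDirections

open Set Filter Topology Asymptotics
open scoped commutatorElement

variable (E : Type*) [NormedAddCommGroup E] [NormedSpace ℝ E]
  {G : Type*} [Group G] [TopologicalSpace G] [ChartedSpace E G]

/-- The limits of multiples of coordinates of elements of `T` tending to the identity. -/
def tangentDirections (T : Set G) : Set E :=
  {v | ∃ (x : ℕ → G) (c : ℕ → ℝ), (∀ n, x n ∈ T) ∧ Tendsto x atTop (𝓝 1) ∧
    Tendsto (fun n => c n • logChart E (x n)) atTop (𝓝 v)}

theorem tangentDirections_univ : tangentDirections E (univ : Set G) = univ := by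
  refine eq_univ_of_forall fun v => ?_
  obtain ⟨x, hx, hv⟩ := exists_seq_logChart E (G := G) v
  exact ⟨x, _, fun _ => mem_univ _, hx, hv⟩

variable {E}

theorem eq_zero_of_mem_tangentDirections_one {v : E}
    (hv : v ∈ tangentDirections E ({1} : Set G)) : v = 0 := by
  obtain ⟨x, c, hx, -, hv⟩ := hv
  have : (fun n => c n • logChart E (x n)) = fun _ => 0 := by
    funext n
    rw [show x n = 1 from hx n, logChart_one, smul_zero]
  rw [this] at hv
  exact tendsto_nhds_unique hv tendsto_const_nhds

theorem HasDerivAtOne.mapsTo_tangentDirections {f : G → G} {L : E →L[ℝ] E}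
    (hf : HasDerivAtOne f L) {T T' : Set G} (hT : MapsTo f T T') :
    MapsTo L (tangentDirections E T) (tangentDirections E T') := by
  rintro v ⟨x, c, hxT, hx, hv⟩
  refine ⟨fun n => f (x n), c, fun n => hT (hxT n), hf.tendsto.comp hx, ?_⟩
  have h1 := hf.isLittleO.comp_tendsto hx
  have h2 : (fun n => c n • (logChart E (f (x n)) - L (logChart E (x n)))) =o[atTop]
      fun n => c n • logChart E (x n) := (isBigO_refl c atTop).smul_isLittleO h1
  have h3 := (isLittleO_one_iff ℝ).1 (h2.trans_isBigO (hv.isBigO_one ℝ))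
  have h4 := h3.add ((L.continuous.tendsto v).comp hv)
  rw [zero_add] at h4
  refine h4.congr fun n => ?_
  simp only [Function.comp_apply, map_smul, smul_sub]
  abel

variable [LieGroup 𝓘(ℝ, E) ∞ G] [IsTopologicalGroup G]

/-- `Ad h - 1` is the derivative of `x ↦ [h, x]`. The first commutator carries `T` into `H` and each
further one descends the lower central series, so the iterate of order `k + 1` is trivial on `T`.
The set `T` need not lie in `H`. -/
theorem exists_pow_adjoint_sub_one_apply_eq_zero {H : Subgroup G} [Group.IsNilpotent H] {h : G}
    (hh : h ∈ H) {T : Set G} (hT : ∀ x ∈ T, ⁅h, x⁆ ∈ H) :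
    ∃ k : ℕ, ∀ v ∈ tangentDirections E T, ((adjoint E h - 1) ^ k) v = 0 := by
  obtain ⟨k, hk⟩ := (Subgroup.isNilpotent_iff_lowerCentralSeries H).1 inferInstance
  have hstep : ∀ j : ℕ, ∀ x ∈ T, (fun x => ⁅h, x⁆)^[j + 1] x ∈ H.lowerCentralSeries j := by
    intro j
    induction j with
    | zero => exact fun x hx => hT x hx
    | succ j ih =>
      intro x hx
      rw [Function.iterate_succ_apply', Subgroup.lowerCentralSeries_succ, Subgroup.commutator_comm]
      exact Subgroup.commutator_mem_commutator hh (ih x hx)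
  refine ⟨k + 1, fun v hv => ?_⟩
  have hmaps : MapsTo ((fun x : G => ⁅h, x⁆)^[k + 1]) T {1} := by
    intro x hx
    have := hstep k x hx
    rw [hk, Subgroup.mem_bot] at this
    exact this
  exact eq_zero_of_mem_tangentDirections_one
    (((HasDerivAtOne.commutator (E := E) h).iterate (k + 1)).mapsTo_tangentDirections hmaps hv)

/-- Otherwise the normalized coordinates of a sequence of counterexamples subconverge to a tangent
direction `v` with `‖A v‖ ≥ ε`. -/
theorem eventually_norm_apply_logChart_le [FiniteDimensional ℝ E] {T : Set G} {A : E →L[ℝ] E}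
    (hA : ∀ v ∈ tangentDirections E T, A v = 0) {ε : ℝ} (hε : 0 < ε) :
    ∀ᶠ x in 𝓝[T] (1 : G), ‖A (logChart E x)‖ ≤ ε * ‖logChart E x‖ := by
  have : ProperSpace E := FiniteDimensional.proper_real E
  have hcg : (𝓝 (1 : G)).IsCountablyGenerated := by
    have h := (chartAt E (1 : G)).nhds_eq_comap_inf_principal (mem_chart_source E (1 : G))
    rw [h]
    infer_instance
  by_contra hcon
  rw [not_eventually] at hcon
  have hcg' : (𝓝[T] (1 : G)).IsCountablyGenerated := by
    rw [nhdsWithin]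
    infer_instance
  obtain ⟨x, hx, hbad⟩ := exists_seq_forall_of_frequently
    (hcon.and_eventually self_mem_nhdsWithin)
  have hx1 : Tendsto x atTop (𝓝 1) := hx.mono_right nhdsWithin_le_nhds
  have hne : ∀ n, logChart E (x n) ≠ 0 := by
    intro n h0
    refine (hbad n).1 ?_
    rw [h0, map_zero, norm_zero, mul_zero]
  obtain ⟨v, -, ψ, hψ, hv⟩ := (isCompact_sphere (0 : E) 1).tendsto_subseq
    (x := fun n => ‖logChart E (x n)‖⁻¹ • logChart E (x n)) (fun n => by
      rw [mem_sphere_zero_iff_norm, norm_smul, norm_inv, norm_norm]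
      exact inv_mul_cancel₀ (norm_ne_zero_iff.2 (hne n)))
  have hvT : v ∈ tangentDirections E T :=
    ⟨x ∘ ψ, fun n => ‖logChart E (x (ψ n))‖⁻¹, fun n => (hbad (ψ n)).2,
      hx1.comp hψ.tendsto_atTop, hv⟩
  have hlim := ((A.continuous.tendsto v).comp hv).norm
  rw [hA v hvT, norm_zero] at hlim
  refine absurd (ge_of_tendsto' hlim fun n => ?_) (not_le.2 hε)
  have h1 := not_le.1 (hbad (ψ n)).1
  simp only [Function.comp_apply, map_smul, norm_smul, norm_inv, norm_norm]
  rw [← div_eq_inv_mul, le_div_iff₀ (norm_pos_iff.2 (hne _))]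
  exact h1.le

/-- A compact subgroup fixing the tangent directions of a normal subgroup `R` centralizes the
elements of `R` close to the identity. -/
theorem eventually_commute_of_adjoint_apply_eq [FiniteDimensional ℝ E] {K R : Subgroup G}
    [R.Normal] (hK : IsCompact (K : Set G))
    (hfix : ∀ t ∈ K, ∀ v ∈ tangentDirections E (R : Set G), adjoint E t v = v) :
    ∀ᶠ x in 𝓝[(R : Set G)] (1 : G), ∀ t ∈ K, ⁅t, x⁆ = 1 := by
  have hconj : ∀ᶠ m in 𝓝 (1 : G), ∀ t ∈ (K : Set G), m ∈ R →
      ‖logChart E (t * m * t⁻¹) - logChart E m‖ ≤ 1 / 4 * ‖logChart E m‖ := by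
    refine hK.eventually_forall_of_forall_eventually fun t ht => ?_
    have h1 : ∀ᶠ z : G × G in 𝓝 (1, t), ‖logChart E (z.2 * z.1 * z.2⁻¹) -
        adjoint E t (logChart E z.1)‖ ≤ 1 / 8 * ‖logChart E z.1‖ :=
      (continuous_swap.tendsto ((1 : G), t)).eventually
        (eventually_norm_logChart_conj E t (by norm_num))
    have h2 : ∀ᶠ m in 𝓝 (1 : G), m ∈ R →
        ‖(adjoint E t - 1) (logChart E m)‖ ≤ 1 / 8 * ‖logChart E m‖ := by
      have h3 := eventually_norm_apply_logChart_le (E := E) (T := (R : Set G))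
        (A := adjoint E t - 1) (fun v hv => by
          rw [sub_apply, hfix t ht v hv]; simp) (by norm_num : (0 : ℝ) < 1 / 8)
      exact eventually_nhdsWithin_iff.1 h3
    have h2' : ∀ᶠ z : G × G in 𝓝 (1, t), z.1 ∈ R →
        ‖(adjoint E t - 1) (logChart E z.1)‖ ≤ 1 / 8 * ‖logChart E z.1‖ :=
      (continuous_fst.tendsto ((1 : G), t)).eventually h2
    filter_upwards [h1, h2'] with z hz1 hz2 hzR
    have h4 : logChart E (z.2 * z.1 * z.2⁻¹) - logChart E z.1 =
        (logChart E (z.2 * z.1 * z.2⁻¹) - adjoint E t (logChart E z.1)) +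
          (adjoint E t - 1) (logChart E z.1) := by
      simp
    rw [h4]
    refine (norm_add_le _ _).trans ?_
    linarith [hz2 hzR]
  have hmul : ∀ᶠ m in 𝓝 (1 : G), ∀ t ∈ (K : Set G),
      ‖logChart E (t * m * t⁻¹ * m) - logChart E (t * m * t⁻¹) - logChart E m‖ ≤
        1 / 8 * (‖logChart E (t * m * t⁻¹)‖ + ‖logChart E m‖) := by
    refine hK.eventually_forall_of_forall_eventually fun t _ => ?_
    have hc : Continuous fun z : G × G => (z.2 * z.1 * z.2⁻¹, z.1) := by fun_prop
    have h1 := hc.tendsto ((1 : G), t)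
    simp only [mul_one, mul_inv_cancel] at h1
    exact h1.eventually (eventually_norm_logChart_mul E (by norm_num))
  have hV := (hconj.and hmul).and ((eventually_eq_one_of_logChart_eq_zero E (G := G)).and
    (extChartAt_source_mem_nhds (I := 𝓘(ℝ, E)) (1 : G)))
  have hcomm : ∀ {Q : G → Prop}, (∀ᶠ m in 𝓝 1, Q m) →
      ∀ᶠ x in 𝓝 (1 : G), ∀ t ∈ (K : Set G), Q ⁅t, x⁆ := fun {Q} hQ =>
    hK.eventually_forall_of_forall_eventually (P := fun x t => Q ⁅t, x⁆) fun t _ => by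
      have hc : Continuous fun z : G × G => ⁅z.2, z.1⁆ := by
        simp only [commutatorElement_def]; fun_prop
      have h1 := hc.tendsto ((1 : G), t)
      simp only [commutatorElement_one_right] at h1
      exact h1.eventually hQ
  filter_upwards [nhdsWithin_le_nhds (hcomm hV), self_mem_nhdsWithin] with x hx hxR
  have hcont : ContinuousOn (fun t => ‖logChart E ⁅t, x⁆‖) (K : Set G) := by
    intro t ht
    have h1 : ContinuousAt (extChartAt 𝓘(ℝ, E) (1 : G)) ⁅t, x⁆ :=
      continuousAt_extChartAt' (hx t ht).2.2
    have h2 : ContinuousAt (logChart E) ⁅t, x⁆ := h1.sub continuousAt_const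
    have h3 : Continuous fun t : G => ⁅t, x⁆ := by
      simp only [commutatorElement_def]; fun_prop
    exact (ContinuousAt.comp (f := fun t : G => ⁅t, x⁆) h2 h3.continuousAt).norm.continuousWithinAt
  -- Since `[t², x] = t [t, x] t⁻¹ · [t, x]` and `t` almost fixes the coordinates of `[t, x] ∈ R`,
  -- replacing `t` by `t²` nearly doubles them. At a maximum they must vanish.
  obtain ⟨t, ht, hmax⟩ := hK.exists_isMaxOn ⟨1, K.one_mem⟩ hcont
  have hmR : ⁅t, x⁆ ∈ R := by
    rw [commutatorElement_def]
    exact R.mul_mem (Subgroup.Normal.conj_mem inferInstance x hxR t) (R.inv_mem hxR)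
  have hsq : ⁅t * t, x⁆ = t * ⁅t, x⁆ * t⁻¹ * ⁅t, x⁆ := by
    simp only [commutatorElement_def]; group
  have h1 := (hx t ht).1.1 t ht hmR
  have h2 := (hx t ht).1.2 t ht
  have h3 : ‖logChart E ⁅t * t, x⁆‖ ≤ ‖logChart E ⁅t, x⁆‖ := hmax (K.mul_mem ht ht)
  rw [hsq] at h3
  set b := logChart E ⁅t, x⁆
  set a := logChart E (t * ⁅t, x⁆ * t⁻¹)
  set d := logChart E (t * ⁅t, x⁆ * t⁻¹ * ⁅t, x⁆)
  have h4 : ‖a‖ ≤ 5 / 4 * ‖b‖ := by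
    have := norm_add_le (a - b) b
    rw [sub_add_cancel] at this
    linarith
  have h5 : 2 * ‖b‖ ≤ ‖d‖ + ‖d - a - b‖ + ‖a - b‖ := by
    have h6 : (2 : ℝ) • b = d - (d - a - b) - (a - b) := by
      rw [two_smul]; abel
    have h7 : ‖(2 : ℝ) • b‖ = 2 * ‖b‖ := by rw [norm_smul]; norm_num
    rw [← h7, h6]
    refine (norm_sub_le _ _).trans ?_
    linarith [norm_sub_le d (d - a - b)]
  have hb : ‖b‖ = 0 := by linarith [norm_nonneg b]
  intro s hs
  refine (hx s hs).2.1 ?_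
  have h8 : ‖logChart E ⁅s, x⁆‖ ≤ ‖b‖ := hmax hs
  rw [hb] at h8
  exact norm_le_zero_iff.1 h8

end TangentDirections


/-! ### σ-compactness of connected groups. -/

section SigmaCompact

open Set Filter Topology
open scoped Pointwise

/-- A connected group is generated by any compact neighbourhood of `1`. This is needed for the open
mapping theorem for `L → S`. -/
theorem sigmaCompactSpace_of_connectedSpace {G : Type*} [Group G] [TopologicalSpace G]
    [IsTopologicalGroup G] [LocallyCompactSpace G] [ConnectedSpace G] : SigmaCompactSpace G := by
  obtain ⟨K, hK, hK1⟩ := exists_compact_mem_nhds (1 : G)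
  set V := K ∪ K⁻¹ with hV
  have hVc : IsCompact V := hK.union hK.inv
  have hpow : ∀ n : ℕ, IsCompact (V ^ n) := by
    intro n
    induction n with
    | zero => rw [pow_zero]; exact isCompact_singleton
    | succ n ih => rw [pow_succ]; exact ih.mul hVc
  have htop : ⊤ ≤ Subgroup.closure K := by
    refine Subgroup.le_of_eventually_mem (by rw [Subgroup.coe_top]; exact isConnected_univ) ?_
    filter_upwards [nhdsWithin_le_nhds hK1] with x hx
    exact Subgroup.subset_closure hx
  refine ⟨fun n => V ^ n, hpow, eq_univ_of_forall fun x => mem_iUnion.2 ?_⟩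
  have hx : x ∈ Subgroup.closure K := htop (Subgroup.mem_top x)
  induction hx using Subgroup.closure_induction_right with
  | one => exact ⟨0, by rw [pow_zero]; exact mem_singleton 1⟩
  | mul_right p hp y hy ih =>
    obtain ⟨n, hn⟩ := ih
    exact ⟨n + 1, by rw [pow_succ]; exact mul_mem_mul hn (Or.inl hy)⟩
  | mul_inv_cancel p hp y hy ih =>
    obtain ⟨n, hn⟩ := ih
    exact ⟨n + 1, by rw [pow_succ]; exact mul_mem_mul hn (Or.inr (by simpa using hy))⟩

end SigmaCompact

theorem isNilpotent_of_le {G : Type*} [Group G] {H K : Subgroup G} (h : H ≤ K)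
    [Group.IsNilpotent K] : Group.IsNilpotent H := by
  obtain ⟨n, hn⟩ := (Subgroup.isNilpotent_iff_lowerCentralSeries K).1 inferInstance
  refine (Subgroup.isNilpotent_iff_lowerCentralSeries H).2 ⟨n, eq_bot_iff.2 ?_⟩
  rw [← hn]
  exact Subgroup.lowerCentralSeries_mono n h

/-! ### Radical and nilradical through the complexified adjoint representation. -/

section AdjointRepresentation

open Set Filter Topology TensorProduct Representation
open scoped commutatorElement

variable (E : Type*) [NormedAddCommGroup E] [NormedSpace ℝ E]
  (G : Type*) [Group G] [TopologicalSpace G] [ChartedSpace E G] [LieGroup 𝓘(ℝ, E) ∞ G]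
  [IsTopologicalGroup G]

/-- The complexified adjoint representation. -/
noncomputable def adjointRep : Representation ℂ G (ℂ ⊗[ℝ] E) where
  toFun g := (adjoint E g : E →ₗ[ℝ] E).baseChange ℂ
  map_one' := by
    rw [adjoint_one]
    exact LinearMap.baseChange_id
  map_mul' g h := by
    rw [adjoint_mul]
    exact LinearMap.baseChange_comp _ _

variable {E G}

@[simp]
theorem adjointRep_tmul (g : G) (z : ℂ) (v : E) :
    adjointRep E G g (z ⊗ₜ v) = z ⊗ₜ adjoint E g v := rfl

theorem one_tmul_injective : Function.Injective fun v : E => (1 : ℂ) ⊗ₜ[ℝ] v :=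
  Module.FaithfullyFlat.tensorProduct_mk_injective (A := ℝ) (B := ℂ) E

theorem adjoint_eq_one_of_adjointRep_eq_one {g : G} (h : adjointRep E G g = 1) :
    adjoint E g = 1 := by
  ext v
  exact one_tmul_injective (LinearMap.congr_fun h (1 ⊗ₜ v))

theorem adjointRep_sub_one_pow_tmul (g : G) (k : ℕ) (z : ℂ) (v : E) :
    ((adjointRep E G g - 1) ^ k) (z ⊗ₜ v) = z ⊗ₜ (((adjoint E g - 1) ^ k) v) := by
  induction k with
  | zero => rfl
  | succ k ih =>
    rw [pow_succ', pow_succ', Module.End.mul_apply, ih, LinearMap.sub_apply, adjointRep_tmul,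
      Module.End.one_apply, ← TensorProduct.tmul_sub]
    rfl

theorem continuousCoeff_adjointRep [FiniteDimensional ℝ E] :
    (adjointRep E G).ContinuousCoeff := by
  intro x f
  induction x using TensorProduct.induction_on with
  | zero => simpa using continuous_const
  | tmul z v =>
    let f' : E →ₗ[ℝ] ℂ := (f.restrictScalars ℝ) ∘ₗ (TensorProduct.mk ℝ ℂ E z)
    have h1 : Continuous f' := f'.continuous_of_finiteDimensional
    have h2 : Continuous fun g : G => adjoint E g v :=
      (ContinuousLinearMap.apply ℝ E v).continuous.comp continuous_adjoint
    exact h1.comp h2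
  | add x y hx hy =>
    simp only [map_add]
    exact Continuous.add hx hy

/-- The complex span of the tangent directions of a normal subgroup. -/
noncomputable def tangentSubrepresentation (E : Type*) [NormedAddCommGroup E] [NormedSpace ℝ E]
    {G : Type*} [Group G] [TopologicalSpace G] [ChartedSpace E G] [LieGroup 𝓘(ℝ, E) ∞ G]
    [IsTopologicalGroup G] (R : Subgroup G) [R.Normal] :
    Subrepresentation (adjointRep E G) where
  toSubmodule := Submodule.span ℂ ((fun v : E => (1 : ℂ) ⊗ₜ[ℝ] v) '' tangentDirections E (R : Set G))
  apply_mem_toSubmodule g v hv := by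
    suffices hle : Submodule.span ℂ ((fun v : E => (1 : ℂ) ⊗ₜ[ℝ] v) ''
        tangentDirections E (R : Set G)) ≤ Submodule.comap (adjointRep E G g)
          (Submodule.span ℂ ((fun v : E => (1 : ℂ) ⊗ₜ[ℝ] v) ''
            tangentDirections E (R : Set G))) from hle hv
    rw [Submodule.span_le]
    rintro _ ⟨w, hw, rfl⟩
    refine Submodule.subset_span ⟨adjoint E g w, ?_, rfl⟩
    exact (HasDerivAtOne.conj g).mapsTo_tangentDirections
      (fun x hx => Subgroup.Normal.conj_mem inferInstance x hx g) hw

theorem one_tmul_mem_tangentSubrepresentation {R : Subgroup G} [R.Normal] {v : E}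
    (hv : v ∈ tangentDirections E (R : Set G)) :
    (1 : ℂ) ⊗ₜ[ℝ] v ∈ (tangentSubrepresentation E R).toSubmodule :=
  Submodule.subset_span ⟨v, hv, rfl⟩

theorem sub_one_pow_eq_zero_of_mem_tangentSubrepresentation {R : Subgroup G} [R.Normal] {g : G}
    {k : ℕ} (hk : ∀ v ∈ tangentDirections E (R : Set G), ((adjoint E g - 1) ^ k) v = 0) :
    ∀ x ∈ (tangentSubrepresentation E R).toSubmodule, ((adjointRep E G g - 1) ^ k) x = 0 := by
  have hle : (tangentSubrepresentation E R).toSubmodule ≤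
      LinearMap.ker ((adjointRep E G g - 1) ^ k) := by
    refine Submodule.span_le.2 ?_
    rintro _ ⟨v, hv, rfl⟩
    simp only [SetLike.mem_coe, LinearMap.mem_ker]
    rw [adjointRep_sub_one_pow_tmul, hk v hv, TensorProduct.tmul_zero]
  exact fun x hx => LinearMap.mem_ker.1 (hle hx)

variable [FiniteDimensional ℝ E] [ConnectedSpace G]

theorem mem_center_of_adjointRep_eq_one (g : G) (h : adjointRep E G g = 1) :
    g ∈ Subgroup.center G :=
  mem_center_of_adjoint_eq_one (adjoint_eq_one_of_adjointRep_eq_one h)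

variable (E G)

/-- Lie–Kolchin gives one inclusion; the other holds because the scalar subgroup is normal and
solvable, the kernel of `Ad` being central. -/
theorem radical_eq_idComponent : radical G = (scalarSubgroup (adjointRep E G)).idComponent := by
  apply le_antisymm
  · refine sSup_le fun H ⟨hconn, hnormal, hsolv⟩ => Subgroup.le_idComponent hconn ?_
    exact le_scalarSubgroup continuousCoeff_adjointRep H hconn
  · have := isSolvable_scalarSubgroup (ρ := adjointRep E G) mem_center_of_adjointRep_eq_one
    exact le_sSup ⟨Subgroup.isConnected_idComponent _, Subgroup.normal_idComponent _,
      Group.isSolvable_of_isSolvable_injective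
        (Subgroup.inclusion_injective (Subgroup.idComponent_le _))⟩

theorem nilradical_eq_idComponent :
    nilradical G = (unipotentSubgroup (adjointRep E G)).idComponent := by
  apply le_antisymm
  · refine sSup_le fun H ⟨hconn, hnormal, hnil⟩ => Subgroup.le_idComponent hconn fun h hh => ?_
    refine mem_unipotentSubgroup_of_isNilpotent
      (le_scalarSubgroup continuousCoeff_adjointRep H hconn hh) ?_
    -- As `H` is normal, `[h, x] ∈ H` for every `x ∈ G`, so `Ad h` is unipotent on all of `E`.
    obtain ⟨k, hk⟩ := exists_pow_adjoint_sub_one_apply_eq_zero (E := E) hh (T := univ)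
      (fun x _ => by
        rw [commutatorElement_def, mul_assoc, mul_assoc, ← mul_assoc x]
        exact H.mul_mem hh (hnormal.conj_mem _ (H.inv_mem hh) x))
    refine ⟨k, LinearMap.ext fun x => ?_⟩
    induction x using TensorProduct.induction_on with
    | zero => simp
    | tmul z v =>
      rw [adjointRep_sub_one_pow_tmul, hk v (by rw [tangentDirections_univ]; trivial),
        TensorProduct.tmul_zero, LinearMap.zero_apply]
    | add x y hx hy => rw [map_add, hx, hy, map_add]
  · have := isNilpotent_unipotentSubgroup (ρ := adjointRep E G) mem_center_of_adjointRep_eq_one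
    exact le_sSup ⟨Subgroup.isConnected_idComponent _, Subgroup.normal_idComponent _,
      isNilpotent_of_le (Subgroup.idComponent_le _)⟩

theorem isConnected_radical
    (E : Type*) [NormedAddCommGroup E] [NormedSpace ℝ E] [FiniteDimensional ℝ E]
    (G : Type*) [Group G] [TopologicalSpace G] [ChartedSpace E G] [LieGroup 𝓘(ℝ, E) ∞ G]
    [IsTopologicalGroup G] [ConnectedSpace G] :
    IsConnected (radical G : Set G) := by
  rw [radical_eq_idComponent E G]
  exact Subgroup.isConnected_idComponent _

theorem normal_radical
    (E : Type*) [NormedAddCommGroup E] [NormedSpace ℝ E] [FiniteDimensional ℝ E]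
    (G : Type*) [Group G] [TopologicalSpace G] [ChartedSpace E G] [LieGroup 𝓘(ℝ, E) ∞ G]
    [IsTopologicalGroup G] [ConnectedSpace G] :
    (radical G).Normal := by
  rw [radical_eq_idComponent E G]
  exact Subgroup.normal_idComponent _

theorem isClosed_radical
    (E : Type*) [NormedAddCommGroup E] [NormedSpace ℝ E] [FiniteDimensional ℝ E]
    (G : Type*) [Group G] [TopologicalSpace G] [ChartedSpace E G] [LieGroup 𝓘(ℝ, E) ∞ G]
    [IsTopologicalGroup G] [ConnectedSpace G] :
    IsClosed (radical G : Set G) := by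
  rw [radical_eq_idComponent E G]
  exact Subgroup.isClosed_idComponent (isClosed_scalarSubgroup continuousCoeff_adjointRep)

theorem radical_le_scalarSubgroup
    (E : Type*) [NormedAddCommGroup E] [NormedSpace ℝ E] [FiniteDimensional ℝ E]
    (G : Type*) [Group G] [TopologicalSpace G] [ChartedSpace E G] [LieGroup 𝓘(ℝ, E) ∞ G]
    [IsTopologicalGroup G] [ConnectedSpace G] :
    radical G ≤ scalarSubgroup (adjointRep E G) := by
  rw [radical_eq_idComponent E G]
  exact Subgroup.idComponent_le _

theorem isConnected_nilradical
    (E : Type*) [NormedAddCommGroup E] [NormedSpace ℝ E] [FiniteDimensional ℝ E]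
    (G : Type*) [Group G] [TopologicalSpace G] [ChartedSpace E G] [LieGroup 𝓘(ℝ, E) ∞ G]
    [IsTopologicalGroup G] [ConnectedSpace G] :
    IsConnected (nilradical G : Set G) := by
  rw [nilradical_eq_idComponent E G]
  exact Subgroup.isConnected_idComponent _

theorem isNilpotent_nilradical
    (E : Type*) [NormedAddCommGroup E] [NormedSpace ℝ E] [FiniteDimensional ℝ E]
    (G : Type*) [Group G] [TopologicalSpace G] [ChartedSpace E G] [LieGroup 𝓘(ℝ, E) ∞ G]
    [IsTopologicalGroup G] [ConnectedSpace G] :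
    Group.IsNilpotent (nilradical G) := by
  rw [nilradical_eq_idComponent E G]
  have := isNilpotent_unipotentSubgroup (ρ := adjointRep E G) mem_center_of_adjointRep_eq_one
  exact isNilpotent_of_le (Subgroup.idComponent_le _)

theorem commutator_radical_le_nilradical
    (E : Type*) [NormedAddCommGroup E] [NormedSpace ℝ E] [FiniteDimensional ℝ E]
    (G : Type*) [Group G] [TopologicalSpace G] [ChartedSpace E G] [LieGroup 𝓘(ℝ, E) ∞ G]
    [IsTopologicalGroup G] [ConnectedSpace G] :
    ⁅(⊤ : Subgroup G), radical G⁆ ≤ nilradical G := by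
  rw [nilradical_eq_idComponent E G]
  refine Subgroup.le_idComponent (Subgroup.isConnected_commutator
    (by rw [Subgroup.coe_top]; exact isConnected_univ) (isConnected_radical E G)) ?_
  exact Subgroup.commutator_le.2 fun g _ r hr =>
    commutator_mem_unipotentSubgroup (radical_le_scalarSubgroup E G hr) g

variable {E G}

/-- A compact subgroup fixing the tangent directions of a connected normal subgroup centralizes
it. -/
theorem commute_of_adjoint_apply_eq {S R : Subgroup G} [R.Normal]
    (hS : IsCompact (S : Set G)) (hR : IsConnected (R : Set G)) {t : G} (ht : t ∈ S)
    (hfix : ∀ v ∈ tangentDirections E (R : Set G), adjoint E t v = v) :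
    ∀ r ∈ R, t * r = r * t := by
  -- All elements of `S` that fix the tangent directions, not just `t`: the maximum argument needs a
  -- compact group.
  let K : Subgroup G :=
    { carrier := {t | t ∈ S ∧ ∀ v ∈ tangentDirections E (R : Set G), adjoint E t v = v}
      one_mem' := ⟨S.one_mem, fun v _ => by rw [adjoint_one]; rfl⟩
      mul_mem' := fun {a b} ha hb => ⟨S.mul_mem ha.1 hb.1, fun v hv => by
        rw [adjoint_mul]
        change adjoint E a (adjoint E b v) = v
        rw [hb.2 v hv, ha.2 v hv]⟩
      inv_mem' := fun {a} ha => ⟨S.inv_mem ha.1, fun v hv => by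
        have h1 : adjoint E a⁻¹ (adjoint E a v) = v := by
          change (adjoint E a⁻¹ * adjoint E a) v = v
          rw [← adjoint_mul, inv_mul_cancel, adjoint_one]
          rfl
        rwa [ha.2 v hv] at h1⟩ }
  have hK : IsCompact (K : Set G) := by
    have hEq : (K : Set G) = (S : Set G) ∩
        ⋂ v ∈ tangentDirections E (R : Set G), {t | adjoint E t v = v} := by
      ext t
      simp only [mem_inter_iff, mem_iInter, mem_ofPred_eq]
      rfl
    rw [hEq]
    refine hS.inter_right (isClosed_biInter fun v _ => isClosed_eq ?_ continuous_const)
    exact (ContinuousLinearMap.apply ℝ E v).continuous.comp continuous_adjoint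
  have hev := eventually_commute_of_adjoint_apply_eq (E := E) (R := R) hK (fun t ht => ht.2)
  have hle : R ≤ Subgroup.centralizer (K : Set G) := by
    refine Subgroup.le_of_eventually_mem hR ?_
    filter_upwards [hev] with x hx
    rw [Subgroup.mem_centralizer_iff]
    exact fun s hs => commutatorElement_eq_one_iff_mul_comm.1 (hx s hs)
  exact fun r hr => Subgroup.mem_centralizer_iff.1 (hle hr) t ⟨ht, hfix⟩

end AdjointRepresentation

/-! ### Identity components of the centre of `S` and of `C_S(R)`. -/

section SemisimplePart

open Set Filter Topology Representation TensorProduct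
open scoped commutatorElement

variable {E : Type v} [NormedAddCommGroup E] [NormedSpace ℝ E] [FiniteDimensional ℝ E]
  {G : Type u} [Group G] [TopologicalSpace G] [T2Space G] [ChartedSpace E G]
  [LieGroup 𝓘(ℝ, E) ∞ G] {S : Subgroup G}

theorem IsSemisimplePart.isConnected (hS : IsSemisimplePart E S) : IsConnected (S : Set G) := by
  obtain ⟨n, L, _, _, _, _, φ, hL, hφ, -, -⟩ := hS
  have := hL.connected
  rw [← hφ.range_eq, MonoidHom.coe_range]
  exact isConnected_range hφ.contMDiff.continuous

/-- The open mapping theorem identifies the topology of `L` with that of the compact group `S`. A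
connected central subgroup of `S` thus comes from a connected normal abelian subgroup of `L`,
contained in the trivial radical of `L`. -/
theorem IsSemisimplePart.idComponent_center_eq_bot (hS : IsSemisimplePart E S)
    (hScompact : IsCompact (S : Set G)) :
    (S ⊓ Subgroup.centralizer (S : Set G)).idComponent = ⊥ := by
  have hGtop : IsTopologicalGroup G := topologicalGroup_of_lieGroup 𝓘(ℝ, E) ∞
  obtain ⟨n, L, _, _, _, _, φ, hL, hφ, -, -⟩ := hS
  have hLtop : IsTopologicalGroup L := topologicalGroup_of_lieGroup (𝓡 n) ∞
  have hLconn := hL.connected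
  have hLloc : LocallyCompactSpace L := Manifold.locallyCompact_of_finiteDimensional (𝓡 n)
  have hLsigma : SigmaCompactSpace L := sigmaCompactSpace_of_connectedSpace
  have hScomp : CompactSpace S := isCompact_iff_compactSpace.1 hScompact
  set Z := (S ⊓ Subgroup.centralizer (S : Set G)).idComponent with hZ
  have hZle : Z ≤ S ⊓ Subgroup.centralizer (S : Set G) := Subgroup.idComponent_le _
  have hφS : ∀ x, φ x ∈ S := fun x => by rw [← hφ.range_eq]; exact ⟨x, rfl⟩
  let ψ : L →* S := φ.codRestrict S hφS
  have hψcont : Continuous ψ := hφ.contMDiff.continuous.subtype_mk hφS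
  have hψsurj : Function.Surjective ψ := by
    rintro ⟨s, hs⟩
    rw [← hφ.range_eq] at hs
    obtain ⟨x, hx⟩ := hs
    exact ⟨x, Subtype.ext hx⟩
  have hψinj : Function.Injective ψ := fun x y hxy => hφ.injective (congrArg Subtype.val hxy)
  have hψopen : IsOpenMap ψ := ψ.isOpenMap_of_sigmaCompact hψsurj hψcont
  have hpre1 : IsPreconnected ((↑) ⁻¹' (Z : Set G) : Set S) := by
    have himg : (Subtype.val '' (Subtype.val ⁻¹' (Z : Set G) : Set S) : Set G) = Z :=
      image_preimage_eq_of_subset fun z hz => ⟨⟨z, (hZle hz).1⟩, rfl⟩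
    have hZconn : IsPreconnected (Z : Set G) := (Subgroup.isConnected_idComponent _).isPreconnected
    rw [← himg] at hZconn
    exact Topology.IsInducing.subtypeVal.isPreconnected_image.1 hZconn
  have hpre2 : IsPreconnected (ψ ⁻¹' ((↑) ⁻¹' (Z : Set G) : Set S)) :=
    hpre1.preimage_of_isOpenMap hψinj hψopen (by rw [hψsurj.range_eq]; exact subset_univ _)
  have hcent : ∀ x ∈ Z.comap φ, ∀ y : L, y * x = x * y := by
    intro x hx y
    refine hφ.injective ?_
    rw [map_mul, map_mul]
    exact Subgroup.mem_centralizer_iff.1 (hZle hx).2 _ (hφS y)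
  have hle : Z.comap φ ≤ radical L := by
    refine le_sSup ⟨⟨⟨1, Subgroup.one_mem _⟩, hpre2⟩, ⟨fun x hx g => ?_⟩, ?_⟩
    · rw [hcent x hx g, mul_inv_cancel_right]
      exact hx
    · exact Group.isSolvable_of_comm fun a b => Subtype.ext (hcent b b.2 a)
  rw [eq_bot_iff]
  intro z hz
  obtain ⟨x, hx⟩ := hψsurj ⟨z, (hZle hz).1⟩
  have hxz : φ x = z := congrArg Subtype.val hx
  have hxr : x ∈ radical L := hle (by rw [Subgroup.mem_comap, hxz]; exact hz)
  rw [hL.radical_eq_bot, Subgroup.mem_bot] at hxr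
  rw [Subgroup.mem_bot, ← hxz, hxr, map_one]

/-- If `S` contains no nontrivial connected closed subgroup that is normal in `G`, then no
nontrivial connected subgroup of `S` centralizes the radical. -/
theorem IsSemisimplePart.idComponent_centralizer_radical_eq_bot [ConnectedSpace G]
    (hS : IsSemisimplePart E S) (hScompact : IsCompact (S : Set G))
    (hSnormal : ∀ K : Subgroup G, K ≤ S → K.Normal → IsConnected (K : Set G) →
      IsClosed (K : Set G) → K = ⊥) :
    (S ⊓ Subgroup.centralizer (radical G : Set G)).idComponent = ⊥ := by
  have hGtop : IsTopologicalGroup G := topologicalGroup_of_lieGroup 𝓘(ℝ, E) ∞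
  have hRnormal := normal_radical E G
  obtain ⟨n, L, _, _, _, _, φ, hL, hφ, hRS, -⟩ := hS
  -- `S` normalizes this group because `R` is normal, `R` commutes with it, and `G = R S`.
  have hCnormal : (S ⊓ Subgroup.centralizer (radical G : Set G)).Normal := by
    refine ⟨fun c hc g => ?_⟩
    obtain ⟨r, hr, s, hs, rfl⟩ := hRS g
    have hsc : s * c * s⁻¹ ∈ S ⊓ Subgroup.centralizer (radical G : Set G) := by
      refine ⟨S.mul_mem (S.mul_mem hs hc.1) (S.inv_mem hs),
        Subgroup.mem_centralizer_iff.2 fun x hx => ?_⟩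
      have h1 := Subgroup.mem_centralizer_iff.1 hc.2 (s⁻¹ * x * s)
        (by simpa using hRnormal.conj_mem x hx s⁻¹)
      calc x * (s * c * s⁻¹) = s * ((s⁻¹ * x * s) * c) * s⁻¹ := by group
        _ = s * (c * (s⁻¹ * x * s)) * s⁻¹ := by rw [h1]
        _ = s * c * s⁻¹ * x := by group
    have h2 := Subgroup.mem_centralizer_iff.1 hsc.2 r hr
    have h3 : r * s * c * (r * s)⁻¹ = r * (s * c * s⁻¹) * r⁻¹ := by group
    rw [h3, h2, mul_inv_cancel_right]
    exact hsc
  refine hSnormal _ ((Subgroup.idComponent_le _).trans inf_le_left)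
    (Subgroup.normal_idComponent _) (Subgroup.isConnected_idComponent _)
    (Subgroup.isClosed_idComponent ?_)
  exact hScompact.isClosed.inter (Set.isClosed_centralizer _)

end SemisimplePart

end LieGroup

/-! ### Maximality of the nilradical. -/

open LieGroup Representation Set in
open scoped commutatorElement TensorProduct in
/-- Every connected nilpotent subgroup containing the nilradical is equal to it. -/
theorem LieGroup.le_nilradical_of_isNilpotent
    {E : Type v} [NormedAddCommGroup E] [NormedSpace ℝ E] [FiniteDimensional ℝ E]
    {G : Type u} [Group G] [TopologicalSpace G] [T2Space G] [ChartedSpace E G]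
    [LieGroup 𝓘(ℝ, E) ∞ G] [ConnectedSpace G]
    {S : Subgroup G} (hS : LieGroup.IsSemisimplePart E S)
    (hScompact : IsCompact (S : Set G))
    (hSnormal : ∀ K : Subgroup G, K ≤ S → K.Normal → IsConnected (K : Set G) →
      IsClosed (K : Set G) → K = ⊥)
    {H : Subgroup G} (hH : IsConnected (H : Set G)) [Group.IsNilpotent H]
    (hN : nilradical G ≤ H) : H ≤ nilradical G := by
  have hGtop : IsTopologicalGroup G := topologicalGroup_of_lieGroup 𝓘(ℝ, E) ∞
  have hRnormal := normal_radical E G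
  have hcommH : ∀ g : G, ∀ r ∈ radical G, ⁅g, r⁆ ∈ H := fun g r hr =>
    hN (commutator_radical_le_nilradical E G
      (Subgroup.commutator_mem_commutator (Subgroup.mem_top g) hr))
  have hRS : ∀ g : G, ∃ r ∈ radical G, ∃ s ∈ S, g = r * s := by
    obtain ⟨_, _, _, _, _, _, _, -, -, hRS, -⟩ := hS
    exact hRS
  have hcenter : ∀ h ∈ H, ∃ r ∈ radical G,
      ∃ z ∈ S ⊓ Subgroup.centralizer (S : Set G), h = r * z := by
    intro h hh
    obtain ⟨r, hr, s, hs, rfl⟩ := hRS h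
    refine ⟨r, hr, s, ⟨hs, ?_⟩, rfl⟩
    obtain ⟨k, hk⟩ := exists_pow_adjoint_sub_one_apply_eq_zero (E := E) hh
      (T := (radical G : Set G)) (fun x hx => hcommH _ x hx)
    have hk' := sub_one_pow_eq_zero_of_mem_tangentSubrepresentation hk
    have hC : ∀ g ∈ S, ⁅g, s⁆ ∈ S ⊓ Subgroup.centralizer (radical G : Set G) := by
      intro g hg
      have hmem : ⁅g, s⁆ ∈ S := by
        rw [commutatorElement_def]
        exact S.mul_mem (S.mul_mem (S.mul_mem hg hs) (S.inv_mem hg)) (S.inv_mem hs)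
      have htriv := apply_eq_of_subquotient_eq_one (continuousCoeff_adjointRep (E := E) (G := G))
        hScompact hmem (C := tangentSubrepresentation E (radical G)) (fun A B hAB hB => by
          obtain ⟨c, hc⟩ := exists_subquotient_eq_smul_one continuousCoeff_adjointRep hScompact
            (radical_le_scalarSubgroup E G hr) hs hAB (fun v hv => hk' v (hB hv))
          exact commutator_eq_one_of_smul_one _ hc g)
      refine ⟨hmem, Subgroup.mem_centralizer_iff.2 fun x hx => ?_⟩
      refine (commute_of_adjoint_apply_eq (E := E) hScompact (isConnected_radical E G) hmem
        (fun v hv => ?_) x hx).symm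
      exact one_tmul_injective (htriv _ (one_tmul_mem_tangentSubrepresentation hv))
    -- These commutators form a connected set through `1` inside `C_S(R)`, whose identity component
    -- is trivial; so all of them equal `1`.
    have hpre : IsPreconnected ((fun g => ⁅g, s⁆) '' (S : Set G)) :=
      hS.isConnected.isPreconnected.image _ (by
        simp only [commutatorElement_def]; fun_prop)
    have hsub := Subgroup.subset_idComponent hpre ⟨1, S.one_mem, commutatorElement_one_left s⟩
      (by rintro _ ⟨g, hg, rfl⟩; exact hC g hg)
    rw [hS.idComponent_centralizer_radical_eq_bot hScompact hSnormal] at hsub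
    refine Subgroup.mem_centralizer_iff.2 fun g hg => ?_
    exact commutatorElement_eq_one_iff_mul_comm.1 (Subgroup.mem_bot.1 (hsub ⟨g, hg, rfl⟩))
  have hHR : H ≤ radical G := by
    have := Subgroup.totallyDisconnectedSpace_of_idComponent_eq_bot
      (hS.idComponent_center_eq_bot hScompact)
    refine Subgroup.le_of_subset_mul_totallyDisconnected hH (isClosed_radical E G) ?_ hcenter
    exact hScompact.inter_right (Set.isClosed_centralizer _)
  -- With `H ≤ R`, normality follows from `[G, R] ≤ N ≤ H`.
  refine le_sSup ⟨hH, ⟨fun h hh g => ?_⟩, inferInstance⟩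
  have : g * h * g⁻¹ = ⁅g, h⁆ * h := by rw [commutatorElement_def]; group
  rw [this]
  exact H.mul_mem (hcommH g h (hHR hh)) hh

theorem lemma4p1
    {E : Type v} [NormedAddCommGroup E] [NormedSpace ℝ E] [FiniteDimensional ℝ E]
    {G : Type u} [Group G] [TopologicalSpace G] [T2Space G] [ChartedSpace E G]
    [LieGroup 𝓘(ℝ, E) ∞ G] [ConnectedSpace G]
    (S : Subgroup G) (hS : LieGroup.IsSemisimplePart E S)
    (hScompact : IsCompact (S : Set G))
    (hSnormal : ∀ K : Subgroup G, K ≤ S → K.Normal → IsConnected (K : Set G) →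
      IsClosed (K : Set G) → K = ⊥) :
    Maximal (fun H : Subgroup G => IsConnected (H : Set G) ∧ Group.IsNilpotent H)
      (LieGroup.nilradical G) := by
  have hGtop : IsTopologicalGroup G := topologicalGroup_of_lieGroup 𝓘(ℝ, E) ∞
  refine ⟨⟨LieGroup.isConnected_nilradical E G, LieGroup.isNilpotent_nilradical E G⟩, ?_⟩
  rintro H ⟨hH, hnil⟩ hN
  exact LieGroup.le_nilradical_of_isNilpotent hS hScompact hSnormal hH hN
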